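/- Let $\mathcal H$ be a complex Hilbert space, let $\mathbb P$ be the cone of positive invertible bounded operators on $\mathcal H$ with the Loewner order $\le$, and for $n\in\mathbb N$ let $\Delta_n$ be the set of $\omega=(w_1,\dots,w_n)\in\mathbb R^n$ with all $w_i>0$ and $\sum_i w_i=1$. An ordered mean is a family $G=\{G_n\}_{n\in\mathbb N}$ of maps $G_n:\Delta_n\times\mathbb P^n\to\mathbb P$ such that for all $\omega\in\Delta_n$, $\mathbf A,\mathbf B\in\mathbb P^n$, $a>0$, $0\le s\le 1$: $G_n(\omega;a\mathbf A)=aG_n(\omega;\mathbf A)$; $G_n(\omega;\mathbf B)\le G_n(\omega;\mathbf A)$ whenever $B_i\le A_i$ for all $i$; $G_n(\omega;(1-s)\mathbf A+s\mathbf B)\ge(1-s)G_n(\omega;\mathbf A)+sG_n(\omega;\mathbf B)$; and $\left[\sum_i w_iA_i^{-1}\right]^{-1}\le G_n(\omega;\mathbf A)\le\sum_i w_iA_i$. For $\mu\ge0$ put $G^\mu(\omega;\mathbf A)=G_n(\omega;A_1+\mu I,\dots,A_n+\mu I)-\mu I$. For $A,B\in\mathbb P$ let $A\#_pB=A^{1/2}(A^{-1/2}BA^{-1/2})^pA^{1/2}$.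 For $\lambda\in\Delta_k$ and $\mathbf C=(C_1,\dots,C_k)\in\mathbb P^k$, the power mean $P_p(\lambda;\mathbf C)$ is, for $0<p\le1$, the unique solution $X\in\mathbb P$ of $X=\sum_j\lambda_j\,(X\#_pC_j)$; for $-1\le p<0$ it is $P_{-p}(\lambda;C_1^{-1},\dots,C_k^{-1})^{-1}$; and $P_0(\lambda;\mathbf C)=\Lambda(\lambda;\mathbf C)$ is the Karcher mean, the unique solution $X\in\mathbb P$ of $\sum_j\lambda_j\log(X^{1/2}C_j^{-1}X^{1/2})=0$. For positive real numbers $\mu_1,\dots,\mu_k$ and $q\ge1$ let $P_q(\lambda;\mu)=\left(\sum_j\lambda_j\mu_j^q\right)^{1/q}$. Theorem. Let $G$ be an ordered mean, $\mathbf A\in\mathbb P^n$, $\omega\in\Delta_n$, $\lambda\in\Delta_k$, $\mu_1,\dots,\mu_k>0$, and write $G^\nu=G^\nu(\omega;\mathbf A)$. Then the means above are well defined: for every $\mathbf C\in\mathbb P^k$ the power mean equation (for each $0<p\le1$) and the Karcher equation have exactly one solution in $\mathbb P$, and $G^{\mu_j}\in\mathbb P$ for all $j$. For all $-1\le p\le1\le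 q$, $$G^{P_q(\lambda;\mu)}\ \ge\ P_p(\lambda;G^{\mu_1},\dots,G^{\mu_k}).$$ Moreover, for all $1\le p\le q$, $$\Lambda(\lambda;G^{\mu_1},\dots,G^{\mu_k})\le P_{1/q}(\lambda;G^{\mu_1},\dots,G^{\mu_k})\le P_{1/p}(\lambda;G^{\mu_1},\dots,G^{\mu_k})\le G^{P_p(\lambda;\mu)}\le G^{P_q(\lambda;\mu)}.$$ -/

import Mathlib

open scoped BigOperators

noncomputable section

/-- The positive probability vectors with `n` entries. -/
def posSimplex (n : ℕ) : Set (Fin n → ℝ) :=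
  {w | (∀ i, 0 < w i) ∧ ∑ i, w i = 1}

section Operators

variable {H : Type*} [NormedAddCommGroup H] [InnerProductSpace ℂ H] [CompleteSpace H]

/-- The weighted arithmetic mean `∑ wᵢ Aᵢ` of operators. -/
def arithMean {n : ℕ} (w : Fin n → ℝ) (A : Fin n → H →L[ℂ] H) : H →L[ℂ] H :=
  ∑ i, w i • A i

/-- The weighted harmonic mean `(∑ wᵢ Aᵢ⁻¹)⁻¹` of operators. -/
def harmMean {n : ℕ} (w : Fin n → ℝ) (A : Fin n → H →L[ℂ] H) : H →L[ℂ] H :=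
  Ring.inverse (∑ i, w i • Ring.inverse (A i))

variable (H) in
/-- An ordered mean: a family of maps `Gₙ : Δₙ × ℙⁿ → ℙ`, where `ℙ` is the cone of positive
invertible operators on `H` (`IsStrictlyPositive`), with the four properties below.  The maps are
written as total functions, and nothing is required of them outside `Δₙ × ℙⁿ`.  The order on
operators is the Loewner order. -/
structure OrderedMean where
  toFun : (n : ℕ) → (Fin n → ℝ) → (Fin n → H →L[ℂ] H) → (H →L[ℂ] H)
  isStrictlyPositive : ∀ (n : ℕ) (w : Fin n → ℝ) (A : Fin n → H →L[ℂ] H),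
    w ∈ posSimplex n → (∀ i, IsStrictlyPositive (A i)) → IsStrictlyPositive (toFun n w A)
  homogeneous : ∀ (n : ℕ) (w : Fin n → ℝ) (A : Fin n → H →L[ℂ] H) (a : ℝ),
    w ∈ posSimplex n → (∀ i, IsStrictlyPositive (A i)) → 0 < a →
    toFun n w (fun i => a • A i) = a • toFun n w A
  monotone : ∀ (n : ℕ) (w : Fin n → ℝ) (A B : Fin n → H →L[ℂ] H),
    w ∈ posSimplex n → (∀ i, IsStrictlyPositive (A i)) → (∀ i, IsStrictlyPositive (B i)) →
    (∀ i, B i ≤ A i) → toFun n w B ≤ toFun n w A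
  jointly_concave : ∀ (n : ℕ) (w : Fin n → ℝ) (A B : Fin n → H →L[ℂ] H) (s : ℝ),
    w ∈ posSimplex n → (∀ i, IsStrictlyPositive (A i)) → (∀ i, IsStrictlyPositive (B i)) →
    0 ≤ s → s ≤ 1 →
    (1 - s) • toFun n w A + s • toFun n w B ≤ toFun n w (fun i => (1 - s) • A i + s • B i)
  harm_le : ∀ (n : ℕ) (w : Fin n → ℝ) (A : Fin n → H →L[ℂ] H),
    w ∈ posSimplex n → (∀ i, IsStrictlyPositive (A i)) → harmMean w A ≤ toFun n w A
  le_arith : ∀ (n : ℕ) (w : Fin n → ℝ) (A : Fin n → H →L[ℂ] H),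
    w ∈ posSimplex n → (∀ i, IsStrictlyPositive (A i)) → toFun n w A ≤ arithMean w A

/-- The parameterized ordered mean `G^μ(w; A)`: it is `G(w; A₁ + μI, …, Aₙ + μI) - μI` for
`μ ≥ 0`, and `G^{-μ}(w; A₁⁻¹, …, Aₙ⁻¹)⁻¹` for `μ < 0`. -/
def OrderedMean.param (G : OrderedMean H) (μ : ℝ) {n : ℕ} (w : Fin n → ℝ)
    (A : Fin n → H →L[ℂ] H) : H →L[ℂ] H :=
  if 0 ≤ μ then
    G.toFun n w (fun i => A i + μ • (1 : H →L[ℂ] H)) - μ • (1 : H →L[ℂ] H)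
  else
    Ring.inverse (G.toFun n w (fun i => Ring.inverse (A i) + (-μ) • (1 : H →L[ℂ] H))
      - (-μ) • (1 : H →L[ℂ] H))

/-- The weighted geometric mean `A #_p B = A^{1/2} (A^{-1/2} B A^{-1/2})^p A^{1/2}` of positive
invertible operators. -/
def geoMean (p : ℝ) (A B : H →L[ℂ] H) : H →L[ℂ] H :=
  A ^ (1 / 2 : ℝ) * (A ^ (-(1 / 2) : ℝ) * B * A ^ (-(1 / 2) : ℝ)) ^ p * A ^ (1 / 2 : ℝ)

/-- `X` is a positive invertible solution of `X = ∑ wᵢ (X #_p Aᵢ)`. -/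
def SolvesPowerEq (p : ℝ) {k : ℕ} (w : Fin k → ℝ) (A : Fin k → H →L[ℂ] H)
    (X : H →L[ℂ] H) : Prop :=
  IsStrictlyPositive X ∧ X = ∑ i, w i • geoMean p X (A i)

/-- `X` is a positive invertible solution of `∑ wᵢ log (X^{1/2} Aᵢ⁻¹ X^{1/2}) = 0`. -/
def SolvesKarcherEq {k : ℕ} (w : Fin k → ℝ) (A : Fin k → H →L[ℂ] H) (X : H →L[ℂ] H) : Prop :=
  IsStrictlyPositive X ∧
    ∑ i, w i • CFC.log (X ^ (1 / 2 : ℝ) * Ring.inverse (A i) * X ^ (1 / 2 : ℝ)) = 0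

/-- The Karcher mean: the solution of the Karcher equation. -/
def karcherMean {k : ℕ} (w : Fin k → ℝ) (A : Fin k → H →L[ℂ] H) : H →L[ℂ] H :=
  Classical.epsilon (SolvesKarcherEq w A)

/-- The power mean `P_p(w; A)`, `-1 ≤ p ≤ 1`: for `p > 0` the solution of the power mean equation,
for `p < 0` the operator `P_{-p}(w; A₁⁻¹, …, A_k⁻¹)⁻¹`, and for `p = 0` the Karcher mean. -/
def powerMean (p : ℝ) {k : ℕ} (w : Fin k → ℝ) (A : Fin k → H →L[ℂ] H) : H →L[ℂ] H :=
  if 0 < p then Classical.epsilon (SolvesPowerEq p w A)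
  else if p < 0 then
    Ring.inverse (Classical.epsilon (SolvesPowerEq (-p) w (fun i => Ring.inverse (A i))))
  else karcherMean w A

end Operators

/-- The power mean `(∑ wᵢ aᵢ^q)^{1/q}` of positive real numbers, for `q ≠ 0`. -/
def realPowerMean (q : ℝ) {k : ℕ} (w a : Fin k → ℝ) : ℝ :=
  (∑ i, w i * a i ^ q) ^ (1 / q)

end

/-! The inequality passes through the arithmetic mean: every power mean with exponent in [-1, 1] is
at most `∑ λⱼ G^{μⱼ}` (`powerMean_le_sum_smul`). Concavity and homogeneity of `G` give `∑ λⱼ G^{μⱼ}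
≤ G^{∑ λⱼ μⱼ}` (`sum_smul_param_le`), and `G^μ` increases with `μ` (`param_mono`), so the scalar
power mean inequality finishes.

The operator means are handled by order. The map `x ↦ ∑ wᵢ (x #_r cᵢ)` is monotone and homogeneous
of degree `1 - r`, hence contracts ratios; so subsolutions lie below supersolutions
(`le_of_gmeanMap`) and monotone iteration converges in norm. Relative to a base point `x`, being a
subsolution means that the average of the `r`-th powers of `x^{-1/2} cᵢ x^{-1/2}` is at least 1, and
scalar inequalities between powers and logarithms then compare different exponents.

The Karcher mean is the norm limit of power means as the exponent tends to 0. Its uniqueness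
(`le_of_logAvg_nonneg_of_logAvg_nonpos`) comes from `d^r = 1 + r log d + O(r²)`. -/

/-! ### The weighted geometric mean of two elements. -/

section GeometricMean

variable {𝓐 : Type*} [CStarAlgebra 𝓐] [PartialOrder 𝓐] [StarOrderedRing 𝓐]

open CFC

/-- The element `x` as seen from the base point `a`: `a^{-1/2} x a^{-1/2}`. -/
noncomputable def relTo (a x : 𝓐) : 𝓐 :=
  a ^ (-(1 / 2) : ℝ) * x * a ^ (-(1 / 2) : ℝ)

/-- The weighted geometric mean in a C⋆-algebra. -/
noncomputable def gmean (r : ℝ) (a b : 𝓐) : 𝓐 :=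
  a ^ (1 / 2 : ℝ) * relTo a b ^ r * a ^ (1 / 2 : ℝ)

theorem IsStrictlyPositive.rpow_const {a : 𝓐} (ha : IsStrictlyPositive a) (r : ℝ) :
    IsStrictlyPositive (a ^ r) :=
  (ha.isUnit.cfcRpow r ha.nonneg).isStrictlyPositive rpow_nonneg

theorem IsStrictlyPositive.conj {a b : 𝓐} (ha : IsStrictlyPositive a)
    (hb : IsStrictlyPositive b) : IsStrictlyPositive (b * a * b) :=
  IsStrictlyPositive.conjugate_of_isUnit_of_isSelfAdjoint a b hb.isUnit hb.isSelfAdjoint ha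

theorem IsStrictlyPositive.relTo {a b : 𝓐} (ha : IsStrictlyPositive a)
    (hb : IsStrictlyPositive b) : IsStrictlyPositive (relTo a b) :=
  hb.conj (ha.rpow_const _)

theorem IsStrictlyPositive.gmean {a b : 𝓐} (ha : IsStrictlyPositive a)
    (hb : IsStrictlyPositive b) (r : ℝ) : IsStrictlyPositive (gmean r a b) :=
  ((ha.relTo hb).rpow_const r).conj (ha.rpow_const _)

theorem IsStrictlyPositive.rpow_half_mul_rpow_half {a : 𝓐} (ha : IsStrictlyPositive a) :
    a ^ (1 / 2 : ℝ) * a ^ (1 / 2 : ℝ) = a := by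
  rw [← rpow_add ha.isUnit, add_halves, rpow_one a ha.nonneg]

theorem conj_rpow_le_conj_rpow {a b c : 𝓐} (r : ℝ) (h : a ≤ b) :
    c ^ r * a * c ^ r ≤ c ^ r * b * c ^ r :=
  IsSelfAdjoint.conjugate_le_conjugate h (IsSelfAdjoint.of_nonneg rpow_nonneg)

theorem relTo_mono {a x y : 𝓐} (h : x ≤ y) : relTo a x ≤ relTo a y :=
  conj_rpow_le_conj_rpow _ h

theorem relTo_self {a : 𝓐} (ha : IsStrictlyPositive a) : relTo a a = 1 :=
  conjugate_rpow_neg_one_half a ha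

theorem relTo_smul (a x : 𝓐) (t : ℝ) : relTo a (t • x) = t • relTo a x := by
  simp [relTo]

theorem smul_rpow {a : 𝓐} (ha : IsStrictlyPositive a) {t : ℝ} (ht : 0 < t) (r : ℝ) :
    (t • a) ^ r = t ^ r • a ^ r := by
  have hs : ∀ x ∈ spectrum ℝ a, 0 < x := fun x hx => ha.spectrum_pos hx
  have hc : ContinuousOn (fun x : ℝ => x ^ r) (spectrum ℝ a) :=
    continuousOn_id.rpow_const fun x hx => Or.inl (hs x hx).ne'
  have h1 : t • a = cfc (fun x : ℝ => t * x) a := by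
    rw [cfc_const_mul t (fun x => x) a, cfc_id' ℝ a ha.isSelfAdjoint]
  rw [h1, cfc_rpow (fun x hx => mul_pos ht (hs x hx)) (by fun_prop) ha.isSelfAdjoint,
    rpow_eq_cfc_real ha.nonneg, ← cfc_smul (t ^ r) (fun x : ℝ => x ^ r) a hc]
  exact cfc_congr fun x hx => by simp [Real.mul_rpow ht.le (hs x hx).le]

theorem conj_unitary_rpow {u a : 𝓐} (hu : u ∈ unitary 𝓐) (ha : IsStrictlyPositive a) (r : ℝ) :
    (u * a * star u) ^ r = u * a ^ r * star u := by
  have hs : ∀ x ∈ spectrum ℝ a, 0 < x := fun x hx => ha.spectrum_pos hx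
  have hc : ContinuousOn (fun x : ℝ => x ^ r) (spectrum ℝ a) :=
    continuousOn_id.rpow_const fun x hx => Or.inl (hs x hx).ne'
  have h2 : 0 ≤ u * a * star u := star_right_conjugate_nonneg ha.nonneg u
  have := StarAlgHomClass.map_cfc (S := ℝ) (Unitary.conjStarAlgAut ℝ 𝓐 ⟨u, hu⟩)
    (fun x : ℝ => x ^ r) a hc
    (by simpa [Unitary.conjStarAlgAut_apply, Function.comp_def] using! (by fun_prop :
      Continuous fun x : 𝓐 => u * x * star u))
    ha.isSelfAdjoint (by simpa [Unitary.conjStarAlgAut_apply] using h2.isSelfAdjoint)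
  rw [rpow_eq_cfc_real ha.nonneg, rpow_eq_cfc_real h2]
  simpa [Unitary.conjStarAlgAut_apply] using this.symm

/-- With `y = relTo b a`, the element `u = a^{-1/2} b^{1/2} y^{1/2}` is unitary and `relTo a b = u
y⁻¹ u*`, so powers pass through `u`. After the swap the left argument occurs only once, inside a
single power; monotonicity, homogeneity and continuity in it follow. -/
theorem gmean_symm {a b : 𝓐} (ha : IsStrictlyPositive a) (hb : IsStrictlyPositive b) (r : ℝ) :
    gmean r a b = gmean (1 - r) b a := by
  have hy : IsStrictlyPositive (relTo b a) := hb.relTo ha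
  set y := relTo b a with hyd
  have ea : a = b ^ (1 / 2 : ℝ) * y * b ^ (1 / 2 : ℝ) := by
    have h1 : b ^ (1 / 2 : ℝ) * b ^ (-(1 / 2) : ℝ) = 1 := rpow_mul_rpow_neg _ hb
    have h2 : b ^ (-(1 / 2) : ℝ) * b ^ (1 / 2 : ℝ) = 1 := rpow_neg_mul_rpow _ hb
    simp only [hyd, relTo]
    calc a = 1 * a * 1 := by simp
      _ = (b ^ (1 / 2 : ℝ) * b ^ (-(1 / 2) : ℝ)) * a * (b ^ (-(1 / 2) : ℝ) * b ^ (1 / 2 : ℝ)) := by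
        rw [h1, h2]
      _ = _ := by simp only [mul_assoc]
  have ha1 : a ^ (1 / 2 : ℝ) * a ^ (-(1 / 2) : ℝ) = 1 := rpow_mul_rpow_neg _ ha
  have ha2 : a ^ (-(1 / 2) : ℝ) * a ^ (1 / 2 : ℝ) = 1 := rpow_neg_mul_rpow _ ha
  have sa {c : 𝓐} (r : ℝ) : star (c ^ r) = c ^ r := (IsSelfAdjoint.of_nonneg rpow_nonneg).star_eq
  have hyh := hy.rpow_half_mul_rpow_half
  have hbh := hb.rpow_half_mul_rpow_half
  set u := a ^ (-(1 / 2) : ℝ) * b ^ (1 / 2 : ℝ) * y ^ (1 / 2 : ℝ) with hu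
  have hus : star u = y ^ (1 / 2 : ℝ) * b ^ (1 / 2 : ℝ) * a ^ (-(1 / 2) : ℝ) := by
    simp only [hu, star_mul, sa, mul_assoc]
  have huu : u * star u = 1 := by
    calc u * star u = a ^ (-(1 / 2) : ℝ) * (b ^ (1 / 2 : ℝ) * (y ^ (1 / 2 : ℝ) * y ^ (1 / 2 : ℝ)) *
          b ^ (1 / 2 : ℝ)) * a ^ (-(1 / 2) : ℝ) := by rw [hus, hu]; simp only [mul_assoc]
      _ = 1 := by rw [hyh, ← ea]; exact relTo_self ha
  have hunit : IsUnit u :=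
    ((ha.rpow_const _).isUnit.mul (hb.rpow_const _).isUnit).mul (hy.rpow_const _).isUnit
  have huu' : star u * u = 1 := by
    have h : u * (star u * u) = u * 1 := by rw [← mul_assoc, huu, one_mul, mul_one]
    exact hunit.mul_left_cancel h
  have hum : u ∈ unitary 𝓐 := ⟨huu', huu⟩
  have hym : y ^ (1 / 2 : ℝ) * y ^ (-1 : ℝ) * y ^ (1 / 2 : ℝ) = 1 := by
    rw [← rpow_add hy.isUnit, ← rpow_add hy.isUnit]
    norm_num [rpow_zero y hy.nonneg]
  have hD : relTo a b = u * y ^ (-1 : ℝ) * star u := by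
    rw [hus, hu]
    calc relTo a b = a ^ (-(1 / 2) : ℝ) * (b ^ (1 / 2 : ℝ) * (y ^ (1 / 2 : ℝ) * y ^ (-1 : ℝ) *
          y ^ (1 / 2 : ℝ)) * b ^ (1 / 2 : ℝ)) * a ^ (-(1 / 2) : ℝ) := by
            rw [hym, mul_one, hbh]; rfl
      _ = _ := by simp only [mul_assoc]
  have hyr : y ^ (1 / 2 : ℝ) * (y ^ (-1 : ℝ)) ^ r * y ^ (1 / 2 : ℝ) = y ^ (1 - r) := by
    rw [rpow_rpow y _ _ (by norm_num) hy, ← rpow_add hy.isUnit, ← rpow_add hy.isUnit]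
    congr 1; ring
  rw [gmean, hD, conj_unitary_rpow hum (hy.rpow_const _), hus, hu, gmean, ← hyr]
  calc _ = (a ^ (1 / 2 : ℝ) * a ^ (-(1 / 2) : ℝ)) * b ^ (1 / 2 : ℝ) * (y ^ (1 / 2 : ℝ) *
        (y ^ (-1 : ℝ)) ^ r * y ^ (1 / 2 : ℝ)) * b ^ (1 / 2 : ℝ) *
        (a ^ (-(1 / 2) : ℝ) * a ^ (1 / 2 : ℝ)) := by simp only [mul_assoc]
    _ = _ := by rw [ha1, ha2, one_mul, mul_one]

theorem gmean_mono_left {a a' b : 𝓐} (ha : IsStrictlyPositive a) (h : a ≤ a')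
    (hb : IsStrictlyPositive b) {r : ℝ} (hr0 : 0 ≤ r) (hr1 : r ≤ 1) :
    gmean r a b ≤ gmean r a' b := by
  rw [gmean_symm ha hb, gmean_symm (ha.of_le h) hb]
  exact conj_rpow_le_conj_rpow _
    (CFC.rpow_le_rpow ⟨by linarith, by linarith⟩ (relTo_mono h))

theorem gmean_smul_left {a b : 𝓐} (ha : IsStrictlyPositive a) (hb : IsStrictlyPositive b)
    {t : ℝ} (ht : 0 < t) (r : ℝ) : gmean r (t • a) b = t ^ (1 - r) • gmean r a b := by
  rw [gmean_symm (ha.smul ht) hb, gmean_symm ha hb, gmean, gmean, relTo_smul,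
    smul_rpow (hb.relTo ha) ht]
  simp

theorem continuousOn_gmean_left {b : 𝓐} (hb : IsStrictlyPositive b) (r : ℝ) :
    ContinuousOn (fun a => gmean r a b) {a | IsStrictlyPositive a} := by
  have h : ContinuousOn (fun a => gmean (1 - r) b a) {a | IsStrictlyPositive a} := by
    have h1 : ContinuousOn (fun a : 𝓐 => relTo b a ^ (1 - r)) {a | IsStrictlyPositive a} :=
      (continuousOn_rpow (1 - r)).comp (f := relTo b)
        (by unfold relTo; fun_prop) (fun a ha => hb.relTo ha)
    exact (continuousOn_const.mul h1).mul continuousOn_const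
  exact h.congr fun a ha => gmean_symm ha hb r

theorem gmean_one {a b : 𝓐} (ha : IsStrictlyPositive a) (hb : IsStrictlyPositive b) :
    gmean 1 a b = b := by
  rw [gmean_symm ha hb, sub_self, gmean, rpow_zero _ (hb.relTo ha).nonneg, mul_one,
    hb.rpow_half_mul_rpow_half]

end GeometricMean

/-! ### The averaged maps and bounds by multiples of the identity. -/

section MeanMap

variable {𝓐 : Type*} [CStarAlgebra 𝓐] [PartialOrder 𝓐] [StarOrderedRing 𝓐]

open CFC Filter Topology

variable {k : ℕ}

/-- The map `x ↦ ∑ wᵢ (x #_r cᵢ)`, whose fixed point is the power mean. -/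
noncomputable def gmeanMap (r : ℝ) (w : Fin k → ℝ) (c : Fin k → 𝓐) (x : 𝓐) : 𝓐 :=
  ∑ i, w i • gmean r x (c i)

/-- The average of the `r`-th powers of the `cᵢ` relative to the base point `x`. -/
noncomputable def powAvg (r : ℝ) (w : Fin k → ℝ) (c : Fin k → 𝓐) (x : 𝓐) : 𝓐 :=
  ∑ i, w i • relTo x (c i) ^ r

/-- The average of the logarithms of the `cᵢ` relative to the base point `x`. -/
noncomputable def logAvg (w : Fin k → ℝ) (c : Fin k → 𝓐) (x : 𝓐) : 𝓐 :=
  ∑ i, w i • CFC.log (relTo x (c i))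

theorem gmeanMap_eq_conj (r : ℝ) (w : Fin k → ℝ) (c : Fin k → 𝓐) (x : 𝓐) :
    gmeanMap r w c x = x ^ (1 / 2 : ℝ) * powAvg r w c x * x ^ (1 / 2 : ℝ) := by
  simp [gmeanMap, powAvg, gmean, Finset.mul_sum, Finset.sum_mul]

theorem sum_smul_const {E : Type*} [AddCommGroup E] [Module ℝ E] {w : Fin k → ℝ}
    (hw : w ∈ posSimplex k) (a : E) :
    ∑ i, w i • a = a := by
  rw [← Finset.sum_smul, hw.2, one_smul]

theorem sum_smul_le_sum_smul {w : Fin k → ℝ} (hw : w ∈ posSimplex k) {a b : Fin k → 𝓐}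
    (h : ∀ i, a i ≤ b i) : ∑ i, w i • a i ≤ ∑ i, w i • b i :=
  Finset.sum_le_sum fun i _ => smul_le_smul_of_nonneg_left (h i) (hw.1 i).le

theorem IsStrictlyPositive.sum_smul {w : Fin k → ℝ} (hw : w ∈ posSimplex k) {a : Fin k → 𝓐}
    (h : ∀ i, IsStrictlyPositive (a i)) : IsStrictlyPositive (∑ i, w i • a i) := by
  have hne : (Finset.univ : Finset (Fin k)).Nonempty := by
    by_contra hcon
    have := hw.2
    simp [Finset.not_nonempty_iff_eq_empty.mp hcon] at this
  obtain ⟨j, hj⟩ := hne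
  exact ((h j).smul (hw.1 j)).of_le (Finset.single_le_sum (f := fun i => w i • a i)
    (fun i _ => smul_nonneg (hw.1 i).le (h i).nonneg) hj)

theorem IsStrictlyPositive.exists_smul_one_le {a : 𝓐} (ha : IsStrictlyPositive a) :
    ∃ t : ℝ, 0 < t ∧ t • (1 : 𝓐) ≤ a := by
  cases subsingleton_or_nontrivial 𝓐
  · exact ⟨1, one_pos, (Subsingleton.elim _ _).le⟩
  · obtain ⟨t, ht, h⟩ := (exists_pos_algebraMap_le_iff ha.isSelfAdjoint).2
      fun x hx => ha.spectrum_pos hx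
    exact ⟨t, ht, by rwa [← Algebra.algebraMap_eq_smul_one]⟩

theorem IsStrictlyPositive.le_norm_smul_one {a : 𝓐} (ha : IsStrictlyPositive a) :
    a ≤ ‖a‖ • (1 : 𝓐) := by
  rw [← Algebra.algebraMap_eq_smul_one]
  exact ha.isSelfAdjoint.le_algebraMap_norm_self

theorem exists_smul_one_le_of_forall {c : Fin k → 𝓐} (hc : ∀ i, IsStrictlyPositive (c i)) :
    ∃ a b : ℝ, 0 < a ∧ 0 < b ∧ ∀ i, a • (1 : 𝓐) ≤ c i ∧ c i ≤ b • (1 : 𝓐) := by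
  choose t ht hle using fun i => (hc i).exists_smul_one_le
  obtain ⟨a, ha, hat⟩ : ∃ a : ℝ, 0 < a ∧ ∀ i, a ≤ t i := by
    rcases isEmpty_or_nonempty (Fin k) with h | h
    · exact ⟨1, one_pos, fun i => h.elim i⟩
    · obtain ⟨i, hi⟩ := Finite.exists_min t
      exact ⟨t i, ht i, hi⟩
  refine ⟨a, 1 + ∑ i, ‖c i‖, ha, by positivity, fun i => ⟨?_, ?_⟩⟩
  · exact (smul_le_smul_of_nonneg_right (hat i) zero_le_one).trans (hle i)
  · refine (hc i).le_norm_smul_one.trans (smul_le_smul_of_nonneg_right ?_ zero_le_one)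
    have := Finset.single_le_sum (f := fun i => ‖c i‖) (fun i _ => norm_nonneg _)
      (Finset.mem_univ i)
    linarith

theorem IsStrictlyPositive.exists_le_smul {x y : 𝓐} (hx : IsStrictlyPositive x)
    (hy : IsStrictlyPositive y) : ∃ t : ℝ, 1 ≤ t ∧ x ≤ t • y := by
  obtain ⟨s, hs, hsy⟩ := hy.exists_smul_one_le
  refine ⟨max 1 (‖x‖ / s), le_max_left _ _, hx.le_norm_smul_one.trans ?_⟩
  calc ‖x‖ • (1 : 𝓐) = (‖x‖ / s) • s • (1 : 𝓐) := by rw [smul_smul, div_mul_cancel₀ _ hs.ne']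
    _ ≤ (‖x‖ / s) • y := smul_le_smul_of_nonneg_left hsy (by positivity)
    _ ≤ _ := smul_le_smul_of_nonneg_right (le_max_right _ _) hy.nonneg

end MeanMap

/-! ### Existence and uniqueness for the power mean equation. -/

section PowerMeanEquation

variable {𝓐 : Type*} [CStarAlgebra 𝓐] [PartialOrder 𝓐] [StarOrderedRing 𝓐]

open CFC Filter Topology

variable {k : ℕ} {w : Fin k → ℝ} {c : Fin k → 𝓐}

theorem IsStrictlyPositive.gmeanMap_of_posSimplex (hw : w ∈ posSimplex k) (hc : ∀ i, IsStrictlyPositive (c i))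
    {x : 𝓐} (hx : IsStrictlyPositive x) (r : ℝ) : IsStrictlyPositive (gmeanMap r w c x) :=
  IsStrictlyPositive.sum_smul hw fun i => hx.gmean (hc i) r

theorem gmeanMap_mono (hw : w ∈ posSimplex k) (hc : ∀ i, IsStrictlyPositive (c i))
    {x y : 𝓐} (hx : IsStrictlyPositive x) (hxy : x ≤ y) {r : ℝ} (hr0 : 0 ≤ r) (hr1 : r ≤ 1) :
    gmeanMap r w c x ≤ gmeanMap r w c y :=
  sum_smul_le_sum_smul hw fun i => gmean_mono_left hx hxy (hc i) hr0 hr1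

theorem gmeanMap_smul (hc : ∀ i, IsStrictlyPositive (c i))
    {x : 𝓐} (hx : IsStrictlyPositive x) {t : ℝ} (ht : 0 < t) (r : ℝ) :
    gmeanMap r w c (t • x) = t ^ (1 - r) • gmeanMap r w c x := by
  simp only [gmeanMap, Finset.smul_sum, gmean_smul_left hx (hc _) ht]
  exact Finset.sum_congr rfl fun i _ => smul_comm _ _ _

theorem continuousOn_gmeanMap (hc : ∀ i, IsStrictlyPositive (c i)) (r : ℝ) :
    ContinuousOn (gmeanMap r w c) {x | IsStrictlyPositive x} :=
  continuousOn_finsetSum _ fun i _ => (continuousOn_gmean_left (hc i) r).const_smul (w i)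

theorem gmeanMap_one (hc : ∀ i, IsStrictlyPositive (c i)) {x : 𝓐} (hx : IsStrictlyPositive x) :
    gmeanMap 1 w c x = ∑ i, w i • c i := by
  simp only [gmeanMap, gmean_one hx (hc _)]

/-- Conjugation by `x^{1/2}` sends 1 to `x`. Bounds on the map thus reduce to bounds on `powAvg`,
which can be proved term by term through the functional calculus. -/
theorem smul_le_gmeanMap {x : 𝓐} (hx : IsStrictlyPositive x) {r t : ℝ}
    (h : t • (1 : 𝓐) ≤ powAvg r w c x) : t • x ≤ gmeanMap r w c x := by
  rw [gmeanMap_eq_conj]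
  calc t • x = x ^ (1 / 2 : ℝ) * t • (1 : 𝓐) * x ^ (1 / 2 : ℝ) := by
        rw [mul_smul_comm, smul_mul_assoc, mul_one, hx.rpow_half_mul_rpow_half]
    _ ≤ _ := conj_rpow_le_conj_rpow _ h

theorem gmeanMap_le_smul {x : 𝓐} (hx : IsStrictlyPositive x) {r t : ℝ}
    (h : powAvg r w c x ≤ t • (1 : 𝓐)) : gmeanMap r w c x ≤ t • x := by
  rw [gmeanMap_eq_conj]
  calc _ ≤ x ^ (1 / 2 : ℝ) * t • (1 : 𝓐) * x ^ (1 / 2 : ℝ) := conj_rpow_le_conj_rpow _ h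
    _ = t • x := by
        rw [mul_smul_comm, smul_mul_assoc, mul_one, hx.rpow_half_mul_rpow_half]

theorem powAvg_eq_one_of_gmeanMap_eq {x : 𝓐} (hx : IsStrictlyPositive x) {r : ℝ}
    (h : x = gmeanMap r w c x) : powAvg r w c x = 1 := by
  have h1 : relTo x x = 1 := relTo_self hx
  have h2 : x ^ (-(1 / 2) : ℝ) * x ^ (1 / 2 : ℝ) = 1 := rpow_neg_mul_rpow _ hx
  have h3 : x ^ (1 / 2 : ℝ) * x ^ (-(1 / 2) : ℝ) = 1 := rpow_mul_rpow_neg _ hx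
  rw [← h1]
  nth_rw 3 [h]
  rw [relTo, gmeanMap_eq_conj]
  calc powAvg r w c x = (x ^ (-(1 / 2) : ℝ) * x ^ (1 / 2 : ℝ)) * powAvg r w c x *
        (x ^ (1 / 2 : ℝ) * x ^ (-(1 / 2) : ℝ)) := by rw [h2, h3, one_mul, mul_one]
    _ = _ := by simp only [mul_assoc]

/-- Contraction with factor `1 - r` in the Thompson metric, in one-sided form. -/
theorem gmeanMap_le_rpow_smul_gmeanMap (hw : w ∈ posSimplex k)
    (hc : ∀ i, IsStrictlyPositive (c i)) {r : ℝ} (hr0 : 0 ≤ r) (hr1 : r ≤ 1) {x y : 𝓐}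
    (hx : IsStrictlyPositive x) (hy : IsStrictlyPositive y) {t : ℝ} (ht : 0 < t)
    (h : x ≤ t • y) : gmeanMap r w c x ≤ t ^ (1 - r) • gmeanMap r w c y := by
  rw [← gmeanMap_smul hc hy ht]
  exact gmeanMap_mono hw hc hx h hr0 hr1

theorem tendsto_rpow_pow_one {t ρ : ℝ} (ht : 0 < t) (h0 : 0 ≤ ρ) (h1 : ρ < 1) :
    Tendsto (fun n : ℕ => t ^ (ρ ^ n)) atTop (𝓝 1) := by
  have := (Real.continuous_const_rpow ht.ne').tendsto 0 |>.comp
    (tendsto_pow_atTop_nhds_zero_of_lt_one h0 h1)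
  simpa [Function.comp_def] using this

/-- A subsolution of the power mean equation lies below every supersolution. -/
theorem IsStrictlyPositive.le_of_gmeanMap (hw : w ∈ posSimplex k)
    (hc : ∀ i, IsStrictlyPositive (c i)) {r : ℝ} (hr0 : 0 < r) (hr1 : r ≤ 1) {x y : 𝓐}
    (hx : IsStrictlyPositive x) (hy : IsStrictlyPositive y)
    (hxf : x ≤ gmeanMap r w c x) (hyf : gmeanMap r w c y ≤ y) : x ≤ y := by
  obtain ⟨t, ht, hxy⟩ := hx.exists_le_smul hy
  have ht0 : 0 < t := by linarith
  -- Each application of the map improves `x ≤ τ • y` to `x ≤ τ^(1-r) • y`, so the factor tends to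
  -- 1.
  have hn : ∀ n : ℕ, x ≤ t ^ ((1 - r) ^ n) • y := by
    intro n
    induction n with
    | zero => simpa using hxy
    | succ n ih =>
      have hp : 0 < t ^ ((1 - r) ^ n) := Real.rpow_pos_of_pos ht0 _
      rw [pow_succ, Real.rpow_mul ht0.le]
      exact hxf.trans ((gmeanMap_le_rpow_smul_gmeanMap hw hc hr0.le hr1 hx hy hp
        ih).trans (smul_le_smul_of_nonneg_left hyf (by positivity)))
  have hlim : Tendsto (fun n : ℕ => t ^ ((1 - r) ^ n) • y) atTop (𝓝 ((1 : ℝ) • y)) :=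
    (tendsto_rpow_pow_one ht0 (by linarith) (by linarith)).smul_const y
  rw [one_smul] at hlim
  exact ge_of_tendsto' hlim hn

theorem exists_le_gmeanMap (hw : w ∈ posSimplex k) (hc : ∀ i, IsStrictlyPositive (c i))
    {r : ℝ} (hr0 : 0 < r) : ∃ x : 𝓐, IsStrictlyPositive x ∧ x ≤ gmeanMap r w c x := by
  have h1 : IsStrictlyPositive (1 : 𝓐) := isStrictlyPositive_one
  obtain ⟨b, hb, hle⟩ := (h1.gmeanMap_of_posSimplex hw hc r).exists_smul_one_le
  have ht : 0 < b ^ (1 / r) := Real.rpow_pos_of_pos hb _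
  -- The scalar `s = b^{1/r}` solves `s^{1-r} b = s`.
  refine ⟨b ^ (1 / r) • 1, h1.smul ht, ?_⟩
  rw [gmeanMap_smul hc h1 ht]
  calc b ^ (1 / r) • (1 : 𝓐) = (b ^ (1 / r)) ^ (1 - r) • b • (1 : 𝓐) := by
        rw [smul_smul, ← Real.rpow_mul hb.le, ← Real.rpow_add_one hb.ne']
        congr 2; field_simp; ring
    _ ≤ _ := smul_le_smul_of_nonneg_left hle (by positivity)

theorem exists_gmeanMap_le (hw : w ∈ posSimplex k) (hc : ∀ i, IsStrictlyPositive (c i))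
    {r : ℝ} (hr0 : 0 < r) : ∃ x : 𝓐, IsStrictlyPositive x ∧ gmeanMap r w c x ≤ x := by
  have h1 : IsStrictlyPositive (1 : 𝓐) := isStrictlyPositive_one
  obtain ⟨b, hb1, hle⟩ := (h1.gmeanMap_of_posSimplex hw hc r).exists_le_smul h1
  have hb : 0 < b := by linarith
  have ht : 0 < b ^ (1 / r) := Real.rpow_pos_of_pos hb _
  refine ⟨b ^ (1 / r) • 1, h1.smul ht, ?_⟩
  rw [gmeanMap_smul hc h1 ht]
  calc _ ≤ (b ^ (1 / r)) ^ (1 - r) • b • (1 : 𝓐) := smul_le_smul_of_nonneg_left hle (by positivity)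
    _ = b ^ (1 / r) • (1 : 𝓐) := by
        rw [smul_smul, ← Real.rpow_mul hb.le, ← Real.rpow_add_one hb.ne']
        congr 2; field_simp; ring

theorem norm_sub_le_of_le_smul {x y : 𝓐} (hxy : x ≤ y) {t : ℝ} (ht : 0 ≤ t)
    (h : y - x ≤ t • x) : ‖y - x‖ ≤ t * ‖x‖ := by
  refine (CStarAlgebra.norm_le_norm_of_nonneg_of_le (sub_nonneg.mpr hxy) h).trans ?_
  rw [norm_smul, Real.norm_of_nonneg ht]

theorem exists_gmeanMap_eq (hw : w ∈ posSimplex k) (hc : ∀ i, IsStrictlyPositive (c i))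
    {r : ℝ} (hr0 : 0 < r) (hr1 : r ≤ 1) :
    ∃ x : 𝓐, IsStrictlyPositive x ∧ x = gmeanMap r w c x := by
  obtain ⟨x₀, hx₀, hle₀⟩ := exists_le_gmeanMap hw hc hr0
  obtain ⟨z, hz, hzle⟩ := exists_gmeanMap_le hw hc hr0
  obtain ⟨t, ht, htx⟩ := (hx₀.gmeanMap_of_posSimplex hw hc r).exists_le_smul hx₀
  have ht0 : 0 < t := by linarith
  set u : ℕ → 𝓐 := fun n => (gmeanMap r w c)^[n] x₀ with hu
  have hsucc : ∀ n, u (n + 1) = gmeanMap r w c (u n) := fun n =>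
    Function.iterate_succ_apply' _ _ _
  have hpos : ∀ n, IsStrictlyPositive (u n) := by
    intro n
    induction n with
    | zero => exact hx₀
    | succ n ih => rw [hsucc]; exact ih.gmeanMap_of_posSimplex hw hc r
  have hmono : ∀ n, u n ≤ u (n + 1) := by
    intro n
    induction n with
    | zero => exact hle₀
    | succ n ih =>
      rw [hsucc (n + 1)]
      nth_rw 1 [hsucc n]
      exact gmeanMap_mono hw hc (hpos n) ih hr0.le hr1
  -- Monotone bounded sequences need not converge in norm; this decay of ratios supplies the Cauchy
  -- property, with the supersolution `z` bounding the norms.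
  have hub : ∀ n, u (n + 1) ≤ t ^ ((1 - r) ^ n) • u n := by
    intro n
    induction n with
    | zero => simpa [hu] using htx
    | succ n ih =>
      rw [pow_succ, Real.rpow_mul ht0.le, hsucc (n + 1)]
      nth_rw 2 [hsucc n]
      exact gmeanMap_le_rpow_smul_gmeanMap hw hc hr0.le hr1 (hpos _) (hpos _)
        (by positivity) ih
  have hbound : ∀ n, ‖u n‖ ≤ ‖z‖ := fun n =>
    CStarAlgebra.norm_le_norm_of_nonneg_of_le (hpos n).nonneg
      ((hpos n).le_of_gmeanMap hw hc hr0 hr1 hz ((hmono n).trans_eq (hsucc n)) hzle)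
  have hρ : 0 ≤ 1 - r := by linarith
  have hcau : CauchySeq u := by
    refine cauchySeq_of_le_geometric (1 - r) ((t - 1) * ‖z‖) (by linarith) fun n => ?_
    rw [dist_comm, dist_eq_norm]
    -- Bernoulli for an exponent in [0, 1] turns the ratio bound into a geometric one.
    have hb : t ^ ((1 - r) ^ n) ≤ 1 + (1 - r) ^ n * (t - 1) := by
      have := rpow_one_add_le_one_add_mul_self (s := t - 1) (by linarith)
        (p := (1 - r) ^ n) (by positivity) (pow_le_one₀ hρ (by linarith))
      simpa using this
    have hnn : 0 ≤ (1 - r) ^ n * (t - 1) := mul_nonneg (by positivity) (by linarith)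
    have h1 : u (n + 1) - u n ≤ ((1 - r) ^ n * (t - 1)) • u n := by
      rw [sub_le_iff_le_add]
      calc u (n + 1) ≤ (1 + (1 - r) ^ n * (t - 1)) • u n :=
            (hub n).trans (smul_le_smul_of_nonneg_right hb (hpos n).nonneg)
        _ = _ := by rw [add_smul, one_smul, add_comm]
    calc ‖u (n + 1) - u n‖ ≤ ((1 - r) ^ n * (t - 1)) * ‖u n‖ :=
          norm_sub_le_of_le_smul (hmono n) hnn h1
      _ ≤ ((1 - r) ^ n * (t - 1)) * ‖z‖ := mul_le_mul_of_nonneg_left (hbound n) hnn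
      _ = _ := by ring
  obtain ⟨x, hx⟩ := cauchySeq_tendsto_of_complete hcau
  have hxpos : IsStrictlyPositive x :=
    hx₀.of_le (monotone_nat_of_le_succ hmono |>.ge_of_tendsto hx 0)
  refine ⟨x, hxpos, ?_⟩
  have h1 : Tendsto (fun n => gmeanMap r w c (u n)) atTop (𝓝 (gmeanMap r w c x)) :=
    ((continuousOn_gmeanMap hc r x hxpos).tendsto).comp
      (tendsto_nhdsWithin_iff.mpr ⟨hx, Eventually.of_forall hpos⟩)
  have h2 : Tendsto (fun n => u (n + 1)) atTop (𝓝 x) := (tendsto_add_atTop_iff_nat 1).mpr hx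
  simp only [hsucc] at h2
  exact tendsto_nhds_unique h2 h1

theorem existsUnique_gmeanMap_eq (hw : w ∈ posSimplex k) (hc : ∀ i, IsStrictlyPositive (c i))
    {r : ℝ} (hr0 : 0 < r) (hr1 : r ≤ 1) :
    ∃! x : 𝓐, IsStrictlyPositive x ∧ x = gmeanMap r w c x := by
  obtain ⟨x, hx, hxf⟩ := exists_gmeanMap_eq hw hc hr0 hr1
  refine ⟨x, ⟨hx, hxf⟩, fun y ⟨hy, hyf⟩ => le_antisymm ?_ ?_⟩
  · exact hy.le_of_gmeanMap hw hc hr0 hr1 hx hyf.le hxf.ge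
  · exact hx.le_of_gmeanMap hw hc hr0 hr1 hy hxf.le hyf.ge

end PowerMeanEquation

/-! ### Comparison of powers and logarithms at a base point. -/

section LogAverage

variable {𝓐 : Type*} [CStarAlgebra 𝓐] [PartialOrder 𝓐] [StarOrderedRing 𝓐]

open CFC Filter Topology

variable {k : ℕ} {w : Fin k → ℝ} {c : Fin k → 𝓐}

theorem cfc_const_add_const_mul {B : Type*} [CStarAlgebra B] {d : B} (hd : IsSelfAdjoint d) (a b : ℝ) {f : ℝ → ℝ}
    (hf : ContinuousOn f (spectrum ℝ d)) :
    cfc (fun x => a + b * f x) d = a • (1 : B) + b • cfc f d := by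
  rw [cfc_const_add a (fun x => b * f x) d (by fun_prop) hd, cfc_const_mul b f d hf,
    Algebra.algebraMap_eq_smul_one]

theorem IsStrictlyPositive.continuousOn_spectrum_log {d : 𝓐} (hd : IsStrictlyPositive d) :
    ContinuousOn Real.log (spectrum ℝ d) :=
  Real.continuousOn_log.mono fun _ hx => (hd.spectrum_pos hx).ne'

theorem IsStrictlyPositive.continuousOn_spectrum_rpow {d : 𝓐} (hd : IsStrictlyPositive d)
    (r : ℝ) : ContinuousOn (fun x : ℝ => x ^ r) (spectrum ℝ d) :=
  continuousOn_id.rpow_const fun _ hx => Or.inl (hd.spectrum_pos hx).ne'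

/-- This is `1 + u ≤ e^u` at `u = r log x`. Negative `r` is allowed, which later covers negative
power means. -/
theorem one_add_smul_log_le_rpow {d : 𝓐} (hd : IsStrictlyPositive d) (r : ℝ) :
    1 + r • CFC.log d ≤ d ^ r := by
  have hl := hd.continuousOn_spectrum_log
  have hr := hd.continuousOn_spectrum_rpow r
  have := cfc_const_add_const_mul hd.isSelfAdjoint 1 r hl
  rw [one_smul] at this
  rw [CFC.log, ← this, rpow_eq_cfc_real hd.nonneg]
  refine cfc_mono (fun x hx => ?_) (by fun_prop) hr
  rw [Real.rpow_def_of_pos (hd.spectrum_pos hx), add_comm, mul_comm]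
  exact Real.add_one_le_exp _

theorem Real.exp_le_one_add_add_sq_mul {u L : ℝ} (h : |u| ≤ L) :
    Real.exp u ≤ 1 + u + u ^ 2 * Real.exp L := by
  have h1 : 1 - u ≤ Real.exp (-u) := by linarith [Real.add_one_le_exp (-u)]
  have h2 : Real.exp u * Real.exp (-u) = 1 := by rw [← Real.exp_add]; simp
  have h3 : Real.exp u - 1 ≤ u * Real.exp u := by nlinarith [Real.exp_pos u]
  have hL : 1 ≤ Real.exp L := Real.one_le_exp ((_root_.abs_nonneg u).trans h)
  have hu : Real.exp u ≤ Real.exp L := Real.exp_le_exp.mpr ((le_abs_self u).trans h)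
  -- By `h3` it suffices that `u (e^u - 1) ≤ u² e^L`; the sign of `u` decides how to bound `e^u -
  -- 1`.
  rcases le_total 0 u with h0 | h0
  · have : u * (Real.exp u - 1) ≤ u * (u * Real.exp L) :=
      mul_le_mul_of_nonneg_left (h3.trans (mul_le_mul_of_nonneg_left hu h0)) h0
    nlinarith
  · have h4 := Real.add_one_le_exp u
    have : u * (Real.exp u - 1) ≤ u * u := by nlinarith
    nlinarith [sq_nonneg u]

/-- The constant in the second order estimate `d ^ r ≤ 1 + r log d + O(r²)` for `d` with
spectrum in `[M⁻¹, M]`. -/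
noncomputable def rpowRemainder (M : ℝ) : ℝ := Real.log M ^ 2 * Real.exp (Real.log M)

theorem rpowRemainder_nonneg (M : ℝ) : 0 ≤ rpowRemainder M := by
  unfold rpowRemainder; positivity

theorem rpow_le_one_add_smul_log {d : 𝓐} (hd : IsStrictlyPositive d) {M : ℝ} (hM : 0 < M)
    (hs : spectrum ℝ d ⊆ Set.Icc M⁻¹ M) {r : ℝ} (hr0 : 0 ≤ r) (hr1 : r ≤ 1) :
    d ^ r ≤ (1 + rpowRemainder M * r ^ 2) • (1 : 𝓐) + r • CFC.log d := by
  have hl := hd.continuousOn_spectrum_log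
  have hr := hd.continuousOn_spectrum_rpow r
  rw [CFC.log, ← cfc_const_add_const_mul hd.isSelfAdjoint _ r hl, rpow_eq_cfc_real hd.nonneg]
  refine cfc_mono (fun x hx => ?_) hr (by fun_prop)
  have hx0 := hd.spectrum_pos hx
  have h1 : |Real.log x| ≤ Real.log M := by
    rw [abs_le]
    constructor
    · rw [← Real.log_inv]; exact Real.log_le_log (by positivity) (hs hx).1
    · exact Real.log_le_log hx0 (hs hx).2
  have h2 : |r * Real.log x| ≤ Real.log M := by
    rw [abs_mul, abs_of_nonneg hr0]
    exact (mul_le_of_le_one_left (_root_.abs_nonneg _) hr1).trans h1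
  have h3 : Real.log x ^ 2 ≤ Real.log M ^ 2 := by
    rw [← sq_abs]; exact pow_le_pow_left₀ (_root_.abs_nonneg _) h1 2
  rw [Real.rpow_def_of_pos hx0, mul_comm]
  refine (Real.exp_le_one_add_add_sq_mul h2).trans ?_
  have h4 : (r * Real.log x) ^ 2 * Real.exp (Real.log M) ≤ rpowRemainder M * r ^ 2 := by
    unfold rpowRemainder
    calc _ = Real.log x ^ 2 * (Real.exp (Real.log M) * r ^ 2) := by ring
      _ ≤ Real.log M ^ 2 * (Real.exp (Real.log M) * r ^ 2) :=
        mul_le_mul_of_nonneg_right h3 (by positivity)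
      _ = _ := by ring
  linarith

/-- Bernoulli's inequality: the tangent at 1 of the convex function `x^t`. Applied to `d^r` with `t
= s / r`, it compares exponents `r ≤ s`. -/
theorem one_add_smul_sub_one_le_rpow {d : 𝓐} (hd : IsStrictlyPositive d) {t : ℝ} (ht : 1 ≤ t) :
    (1 - t) • (1 : 𝓐) + t • d ≤ d ^ t := by
  have hr := hd.continuousOn_spectrum_rpow t
  have h := cfc_const_add_const_mul (f := id) hd.isSelfAdjoint (1 - t) t continuousOn_id
  rw [cfc_id ℝ d hd.isSelfAdjoint] at h
  rw [← h, rpow_eq_cfc_real hd.nonneg]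
  refine cfc_mono (fun x hx => ?_) (by fun_prop) hr
  have := one_add_mul_self_le_rpow_one_add (s := x - 1) (by linarith [hd.spectrum_pos hx]) ht
  rw [add_sub_cancel] at this
  simp only [id]
  linarith

theorem log_rpow {d : 𝓐} (hd : IsStrictlyPositive d) (t : ℝ) :
    CFC.log (d ^ t) = t • CFC.log d := by
  have hl := hd.continuousOn_spectrum_log
  have hr := hd.continuousOn_spectrum_rpow t
  rw [rpow_eq_cfc_real hd.nonneg, CFC.log, CFC.log, ← cfc_const_mul t _ d hl,
    ← cfc_comp' Real.log (fun x => x ^ t) d ?_ hr hd.isSelfAdjoint]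
  · exact cfc_congr fun x hx => Real.log_rpow (hd.spectrum_pos hx) t
  · rintro _ ⟨x, hx, rfl⟩
    exact (Real.continuousAt_log (Real.rpow_pos_of_pos (hd.spectrum_pos hx) t).ne').continuousWithinAt

theorem conj_inverse_eq_relTo_rpow {a x : 𝓐} (ha : IsStrictlyPositive a)
    (hx : IsStrictlyPositive x) :
    a ^ (1 / 2 : ℝ) * Ring.inverse x * a ^ (1 / 2 : ℝ) = relTo a x ^ (-1 : ℝ) := by
  have hd := ha.relTo hx
  have h1 : a ^ (1 / 2 : ℝ) * a ^ (-(1 / 2) : ℝ) = 1 := rpow_mul_rpow_neg _ ha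
  have h2 : a ^ (1 / 2 : ℝ) * Ring.inverse x * a ^ (1 / 2 : ℝ) * relTo a x = 1 := by
    calc _ = a ^ (1 / 2 : ℝ) * (Ring.inverse x * (a ^ (1 / 2 : ℝ) * a ^ (-(1 / 2) : ℝ)) * x) *
          a ^ (-(1 / 2) : ℝ) := by simp only [relTo, mul_assoc]
      _ = 1 := by rw [h1, mul_one, Ring.inverse_mul_cancel x hx.isUnit, mul_one, h1]
  have h3 : relTo a x * relTo a x ^ (-1 : ℝ) = 1 := by
    nth_rw 1 [← rpow_one (relTo a x) hd.nonneg]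
    exact rpow_mul_rpow_neg 1 hd
  exact left_inv_eq_right_inv h2 h3

theorem relTo_inverse {a x : 𝓐} (ha : IsStrictlyPositive a) (hx : IsStrictlyPositive x) :
    relTo (Ring.inverse a) (Ring.inverse x) = relTo a x ^ (-1 : ℝ) := by
  rw [← conj_inverse_eq_relTo_rpow ha hx, relTo, inverse_eq_rpow_neg_one ha,
    rpow_rpow a _ _ (by norm_num) ha]
  norm_num

/-- Inverting all data only changes the sign of the exponent, so negative power means need no
separate theory. -/
theorem powAvg_inverse (hc : ∀ i, IsStrictlyPositive (c i)) {x : 𝓐} (hx : IsStrictlyPositive x)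
    (r : ℝ) :
    powAvg r w (fun i => Ring.inverse (c i)) (Ring.inverse x) = powAvg (-r) w c x := by
  simp only [powAvg, relTo_inverse hx (hc _), rpow_rpow _ (-1) r (by norm_num) (hx.relTo (hc _)),
    neg_one_mul]

theorem one_add_smul_logAvg_le_powAvg (hw : w ∈ posSimplex k)
    (hc : ∀ i, IsStrictlyPositive (c i)) {x : 𝓐} (hx : IsStrictlyPositive x) (r : ℝ) :
    1 + r • logAvg w c x ≤ powAvg r w c x := by
  have := sum_smul_le_sum_smul hw fun i => one_add_smul_log_le_rpow (hx.relTo (hc i)) r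
  simp only [smul_add, Finset.sum_add_distrib, sum_smul_const hw] at this
  simpa only [logAvg, powAvg, Finset.smul_sum, smul_comm r] using this

theorem powAvg_le_add_smul_logAvg (hw : w ∈ posSimplex k)
    (hc : ∀ i, IsStrictlyPositive (c i)) {x : 𝓐} (hx : IsStrictlyPositive x) {M : ℝ} (hM : 0 < M)
    (hs : ∀ i, spectrum ℝ (relTo x (c i)) ⊆ Set.Icc M⁻¹ M) {r : ℝ} (hr0 : 0 ≤ r) (hr1 : r ≤ 1) :
    powAvg r w c x ≤ (1 + rpowRemainder M * r ^ 2) • (1 : 𝓐) + r • logAvg w c x := by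
  have := sum_smul_le_sum_smul hw fun i =>
    rpow_le_one_add_smul_log (hx.relTo (hc i)) hM (hs i) hr0 hr1
  simp only [smul_add, Finset.sum_add_distrib, sum_smul_const hw] at this
  simpa only [logAvg, powAvg, Finset.smul_sum, smul_comm r] using this

theorem add_smul_powAvg_le_powAvg (hw : w ∈ posSimplex k)
    (hc : ∀ i, IsStrictlyPositive (c i)) {x : 𝓐} (hx : IsStrictlyPositive x) {r s : ℝ}
    (hr : 0 < r) (hrs : r ≤ s) :
    (1 - s / r) • (1 : 𝓐) + (s / r) • powAvg r w c x ≤ powAvg s w c x := by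
  have := sum_smul_le_sum_smul hw fun i =>
    one_add_smul_sub_one_le_rpow ((hx.relTo (hc i)).rpow_const r) (t := s / r)
      ((one_le_div hr).mpr hrs)
  simp only [smul_add, Finset.sum_add_distrib, sum_smul_const hw,
    rpow_rpow _ r (s / r) hr.ne' (hx.relTo (hc _)), mul_div_cancel₀ s hr.ne'] at this
  simpa only [powAvg, Finset.smul_sum, smul_comm (s / r)] using this

/-- If the logarithmic average at `x` is nonnegative, `x` is a subsolution of every power mean
equation. -/
theorem le_gmeanMap_of_logAvg_nonneg (hw : w ∈ posSimplex k)
    (hc : ∀ i, IsStrictlyPositive (c i)) {x : 𝓐} (hx : IsStrictlyPositive x)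
    (h : 0 ≤ logAvg w c x) {r : ℝ} (hr : 0 ≤ r) : x ≤ gmeanMap r w c x := by
  have h1 : (1 : ℝ) • (1 : 𝓐) ≤ powAvg r w c x := by
    rw [one_smul]
    exact (le_add_of_nonneg_right (smul_nonneg hr h)).trans
      (one_add_smul_logAvg_le_powAvg hw hc hx r)
  simpa using smul_le_gmeanMap hx h1

theorem le_gmeanMap_of_eq_gmeanMap (hw : w ∈ posSimplex k)
    (hc : ∀ i, IsStrictlyPositive (c i)) {x : 𝓐} (hx : IsStrictlyPositive x) {r s : ℝ}
    (hr : 0 < r) (hrs : r ≤ s) (h : x = gmeanMap r w c x) : x ≤ gmeanMap s w c x := by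
  have h1 : (1 : ℝ) • (1 : 𝓐) ≤ powAvg s w c x := by
    have := add_smul_powAvg_le_powAvg hw hc hx hr hrs
    -- The tangent bound becomes `(1 - s/r) + s/r = 1`, because the average of exponent `r` equals 1
    -- at `x`.
    rwa [powAvg_eq_one_of_gmeanMap_eq hx h, ← add_smul, sub_add_cancel] at this
  simpa using smul_le_gmeanMap hx h1

theorem smul_one_le_relTo {x y : 𝓐} (hx : IsStrictlyPositive x) {t : ℝ} (h : t • x ≤ y) :
    t • (1 : 𝓐) ≤ relTo x y := by
  rw [← relTo_self hx, ← relTo_smul]; exact relTo_mono h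

theorem relTo_le_smul_one {x y : 𝓐} (hx : IsStrictlyPositive x) {t : ℝ} (h : y ≤ t • x) :
    relTo x y ≤ t • (1 : 𝓐) := by
  rw [← relTo_self hx, ← relTo_smul]; exact relTo_mono h

theorem le_gmeanMap_of_forall_le (hw : w ∈ posSimplex k) {x : 𝓐} (hx : IsStrictlyPositive x)
    (h : ∀ i, x ≤ c i) {r : ℝ} (hr0 : 0 ≤ r) (hr1 : r ≤ 1) : x ≤ gmeanMap r w c x := by
  have h1 : (1 : ℝ) • (1 : 𝓐) ≤ powAvg r w c x := by
    rw [one_smul, ← sum_smul_const hw (1 : 𝓐)]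
    refine sum_smul_le_sum_smul hw fun i => ?_
    have := smul_one_le_relTo (t := 1) hx (by simpa using h i)
    simpa using CFC.rpow_le_rpow ⟨hr0, hr1⟩ this
  simpa using smul_le_gmeanMap hx h1

theorem gmeanMap_le_of_forall_le (hw : w ∈ posSimplex k) {x : 𝓐} (hx : IsStrictlyPositive x)
    (h : ∀ i, c i ≤ x) {r : ℝ} (hr0 : 0 ≤ r) (hr1 : r ≤ 1) : gmeanMap r w c x ≤ x := by
  have h1 : powAvg r w c x ≤ (1 : ℝ) • (1 : 𝓐) := by
    rw [one_smul, ← sum_smul_const hw (1 : 𝓐)]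
    refine sum_smul_le_sum_smul hw fun i => ?_
    have := relTo_le_smul_one (t := 1) hx (by simpa using h i)
    simpa using CFC.rpow_le_rpow ⟨hr0, hr1⟩ this
  simpa using gmeanMap_le_smul hx h1

theorem spectrum_relTo_subset {x y : 𝓐} (hx : IsStrictlyPositive x) (hy : IsStrictlyPositive y)
    {s t : ℝ} (hl : s • x ≤ y) (hu : y ≤ t • x) : spectrum ℝ (relTo x y) ⊆ Set.Icc s t := by
  have hsa := (hx.relTo hy).isSelfAdjoint
  have h1 := smul_one_le_relTo hx hl
  have h2 := relTo_le_smul_one hx hu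
  rw [← Algebra.algebraMap_eq_smul_one] at h1 h2
  exact fun z hz => ⟨(algebraMap_le_iff_le_spectrum hsa).1 h1 z hz,
    (le_algebraMap_iff_spectrum_le hsa).1 h2 z hz⟩

theorem exists_spectrum_relTo_subset (hc : ∀ i, IsStrictlyPositive (c i)) {x : 𝓐}
    (hx : IsStrictlyPositive x) :
    ∃ M : ℝ, 0 < M ∧ ∀ i, spectrum ℝ (relTo x (c i)) ⊆ Set.Icc M⁻¹ M := by
  obtain ⟨a, b, ha, hb, hab⟩ := exists_smul_one_le_of_forall hc
  obtain ⟨s, hs, hsx⟩ := hx.exists_smul_one_le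
  have hM : 0 < max (b / s) (‖x‖ / a) + 1 := by positivity
  refine ⟨max (b / s) (‖x‖ / a) + 1, hM, fun i => spectrum_relTo_subset hx (hc i) ?_ ?_⟩
  · refine le_trans ?_ (hab i).1
    rw [inv_smul_le_iff_of_pos hM, smul_smul]
    refine hx.le_norm_smul_one.trans (smul_le_smul_of_nonneg_right ?_ zero_le_one)
    rw [← div_le_iff₀ ha]
    linarith [le_max_right (b / s) (‖x‖ / a)]
  · calc c i ≤ b • (1 : 𝓐) := (hab i).2
      _ = (b / s) • s • (1 : 𝓐) := by rw [smul_smul, div_mul_cancel₀ _ hs.ne']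
      _ ≤ (b / s) • x := smul_le_smul_of_nonneg_left hsx (by positivity)
      _ ≤ _ := smul_le_smul_of_nonneg_right (by linarith [le_max_left (b / s) (‖x‖ / a)]) hx.nonneg

end LogAverage

/-! ### The Karcher equation as the limit of exponent 0. -/

section KarcherEquation

variable {𝓐 : Type*} [CStarAlgebra 𝓐] [PartialOrder 𝓐] [StarOrderedRing 𝓐]

open CFC Filter Topology

variable {k : ℕ} {w : Fin k → ℝ} {c : Fin k → 𝓐}

/-- Here `x` is a subsolution for each exponent `r`, while `y` is a supersolution up to `1 + K r²`.
The multiple `e^{Kr} y` is a true supersolution, since `e^{Kr(1-r)} e^{Kr²} = e^{Kr}`; then `r → 0`.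
-/
theorem le_of_logAvg_nonneg_of_logAvg_nonpos (hw : w ∈ posSimplex k) (hc : ∀ i, IsStrictlyPositive (c i))
    {x y : 𝓐} (hx : IsStrictlyPositive x) (hy : IsStrictlyPositive y)
    (hxl : 0 ≤ logAvg w c x) (hyl : logAvg w c y ≤ 0) : x ≤ y := by
  obtain ⟨M, hM, hs⟩ := exists_spectrum_relTo_subset hc hy
  set K := rpowRemainder M
  have key : ∀ r : ℝ, 0 < r → r ≤ 1 → x ≤ Real.exp (K * r) • y := by
    intro r hr0 hr1
    refine hx.le_of_gmeanMap hw hc hr0 hr1 (hy.smul (Real.exp_pos _))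
      (le_gmeanMap_of_logAvg_nonneg hw hc hx hxl hr0.le) ?_
    rw [gmeanMap_smul hc hy (Real.exp_pos _)]
    have h1 : powAvg r w c y ≤ (1 + K * r ^ 2) • (1 : 𝓐) :=
      (powAvg_le_add_smul_logAvg hw hc hy hM hs hr0.le hr1).trans
        (add_le_of_nonpos_right (smul_nonpos_of_nonneg_of_nonpos hr0.le hyl))
    calc _ ≤ Real.exp (K * r) ^ (1 - r) • (1 + K * r ^ 2) • y :=
          smul_le_smul_of_nonneg_left (gmeanMap_le_smul hy h1) (by positivity)
      _ ≤ Real.exp (K * r) ^ (1 - r) • Real.exp (K * r ^ 2) • y := by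
          refine smul_le_smul_of_nonneg_left (smul_le_smul_of_nonneg_right ?_ hy.nonneg)
            (by positivity)
          rw [add_comm]; exact Real.add_one_le_exp _
      _ = _ := by
          rw [smul_smul, ← Real.exp_mul, ← Real.exp_add]; congr 2; ring
  have hlim : Tendsto (fun r : ℝ => Real.exp (K * r) • y) (𝓝[>] 0) (𝓝 y) := by
    have h : Continuous fun r : ℝ => Real.exp (K * r) • y := by fun_prop
    simpa using (h.tendsto 0).mono_left nhdsWithin_le_nhds
  refine ge_of_tendsto hlim ?_
  filter_upwards [Ioc_mem_nhdsGT (zero_lt_one' ℝ)] with r hr using key r hr.1 hr.2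

/-- The bounds do not depend on `r`, so one remainder constant serves all power means as the
exponent tends to 0. -/
theorem gmeanMap_eq_mem_Icc (hw : w ∈ posSimplex k) (hc : ∀ i, IsStrictlyPositive (c i))
    {a b : ℝ} (ha : 0 < a) (hb : 0 < b) (hab : ∀ i, a • (1 : 𝓐) ≤ c i ∧ c i ≤ b • (1 : 𝓐))
    {r : ℝ} (hr0 : 0 < r) (hr1 : r ≤ 1) {x : 𝓐} (hx : IsStrictlyPositive x)
    (h : x = gmeanMap r w c x) : a • (1 : 𝓐) ≤ x ∧ x ≤ b • (1 : 𝓐) := by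
  have h1 : IsStrictlyPositive (1 : 𝓐) := isStrictlyPositive_one
  exact ⟨(h1.smul ha).le_of_gmeanMap hw hc hr0 hr1 hx
      (le_gmeanMap_of_forall_le hw (h1.smul ha) (fun i => (hab i).1) hr0.le hr1) h.ge,
    hx.le_of_gmeanMap hw hc hr0 hr1 (h1.smul hb) h.le
      (gmeanMap_le_of_forall_le hw (h1.smul hb) (fun i => (hab i).2) hr0.le hr1)⟩

theorem spectrum_relTo_subset_of_mem_Icc {a b : ℝ} (ha : 0 < a) (hb : 0 < b) {x y : 𝓐}
    (hx : a • (1 : 𝓐) ≤ x ∧ x ≤ b • (1 : 𝓐)) (hy : a • (1 : 𝓐) ≤ y ∧ y ≤ b • (1 : 𝓐)) :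
    spectrum ℝ (relTo x y) ⊆ Set.Icc (b / a)⁻¹ (b / a) := by
  have h1 : IsStrictlyPositive (a • (1 : 𝓐)) := isStrictlyPositive_one.smul ha
  refine spectrum_relTo_subset (h1.of_le hx.1) (h1.of_le hy.1) ?_ ?_
  · calc (b / a)⁻¹ • x ≤ (b / a)⁻¹ • b • (1 : 𝓐) :=
          smul_le_smul_of_nonneg_left hx.2 (by positivity)
      _ = a • (1 : 𝓐) := by rw [smul_smul]; congr 1; field_simp
      _ ≤ y := hy.1
  · calc y ≤ b • (1 : 𝓐) := hy.2
      _ = (b / a) • a • (1 : 𝓐) := by rw [smul_smul, div_mul_cancel₀ _ ha.ne']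
      _ ≤ (b / a) • x := smul_le_smul_of_nonneg_left hx.1 (by positivity)

/-- At the power mean of exponent `s` the logarithmic average is `O(s)`. -/
theorem logAvg_of_gmeanMap_eq (hw : w ∈ posSimplex k) (hc : ∀ i, IsStrictlyPositive (c i))
    {x : 𝓐} (hx : IsStrictlyPositive x) {M : ℝ} (hM : 0 < M)
    (hs : ∀ i, spectrum ℝ (relTo x (c i)) ⊆ Set.Icc M⁻¹ M) {s : ℝ} (hs0 : 0 < s) (hs1 : s ≤ 1)
    (h : x = gmeanMap s w c x) :
    -((rpowRemainder M * s) • (1 : 𝓐)) ≤ logAvg w c x ∧ logAvg w c x ≤ 0 := by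
  have hp := powAvg_eq_one_of_gmeanMap_eq hx h
  constructor
  · have h1 := powAvg_le_add_smul_logAvg hw hc hx hM hs hs0.le hs1
    rw [hp, add_smul, one_smul, add_assoc, le_add_iff_nonneg_right, pow_two, ← mul_assoc,
      mul_comm _ s, mul_smul, ← smul_add] at h1
    rw [neg_le_iff_add_nonneg']
    exact (smul_nonneg_iff_nonneg_of_pos_left hs0).1 h1
  · have h1 := one_add_smul_logAvg_le_powAvg hw hc hx s
    rw [hp, add_le_iff_nonpos_right] at h1
    exact (smul_nonpos_iff_nonpos_of_pos_left hs0).1 h1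

/-- Power means of exponents `r ≤ s` differ by a factor `1 + O(s)`. -/
theorem smul_le_of_gmeanMap_eq (hw : w ∈ posSimplex k) (hc : ∀ i, IsStrictlyPositive (c i))
    {x y : 𝓐} (hx : IsStrictlyPositive x) (hy : IsStrictlyPositive y) {M : ℝ} (hM : 0 < M)
    (hs : ∀ i, spectrum ℝ (relTo x (c i)) ⊆ Set.Icc M⁻¹ M) {r s : ℝ} (hr0 : 0 < r) (hr1 : r ≤ 1)
    (hs0 : 0 < s) (hs1 : s ≤ 1) (hxs : x = gmeanMap s w c x) (hyr : y = gmeanMap r w c y) :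
    (1 - rpowRemainder M * s) • x ≤ y := by
  set t := 1 - rpowRemainder M * s with ht
  rcases le_or_gt t 0 with h0 | h0
  · exact (smul_nonpos_of_nonpos_of_nonneg h0 hx.nonneg).trans hy.nonneg
  refine (hx.smul h0).le_of_gmeanMap hw hc hr0 hr1 hy ?_ hyr.ge
  -- At `x` the logarithmic average is at least `-K s`, so the average of exponent `r` is at least
  -- `1 - r K s`, which dominates `(1 - K s)^r` by Bernoulli. Homogeneity then makes `t • x` a
  -- subsolution for `r`.
  have h1 : (t ^ r) • (1 : 𝓐) ≤ powAvg r w c x := by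
    have hb : t ^ r ≤ 1 - r * (rpowRemainder M * s) := by
      have := rpow_one_add_le_one_add_mul_self (s := t - 1) (by linarith) hr0.le hr1
      rw [add_sub_cancel] at this
      rw [ht] at this ⊢
      linarith
    calc (t ^ r) • (1 : 𝓐) ≤ (1 - r * (rpowRemainder M * s)) • (1 : 𝓐) :=
          smul_le_smul_of_nonneg_right hb zero_le_one
      _ = 1 + r • -((rpowRemainder M * s) • (1 : 𝓐)) := by
          rw [sub_smul, one_smul, mul_smul, smul_neg, sub_eq_add_neg]
      _ ≤ 1 + r • logAvg w c x := by
          gcongr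
          exact (logAvg_of_gmeanMap_eq hw hc hx hM hs hs0 hs1 hxs).1
      _ ≤ _ := one_add_smul_logAvg_le_powAvg hw hc hx r
  rw [gmeanMap_smul hc hx h0]
  calc t • x = t ^ (1 - r) • t ^ r • x := by
        rw [smul_smul, ← Real.rpow_add h0]; simp
    _ ≤ _ := smul_le_smul_of_nonneg_left (smul_le_gmeanMap hx h1) (by positivity)

theorem continuousOn_logAvg (hc : ∀ i, IsStrictlyPositive (c i)) :
    ContinuousOn (logAvg w c) {x | IsStrictlyPositive x} := by
  refine continuousOn_finsetSum _ fun i _ => ContinuousOn.const_smul ?_ (w i)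
  have h1 : ContinuousOn (fun x : 𝓐 => x ^ (-(1 / 2) : ℝ)) {x | IsStrictlyPositive x} :=
    continuousOn_rpow _
  exact continuousOn_log.comp ((h1.mul continuousOn_const).mul h1)
    fun x hx => ⟨(IsStrictlyPositive.relTo hx (hc i)).isSelfAdjoint,
      (IsStrictlyPositive.relTo hx (hc i)).isUnit⟩

theorem exists_logAvg_eq_zero (hw : w ∈ posSimplex k) (hc : ∀ i, IsStrictlyPositive (c i)) :
    ∃ x : 𝓐, IsStrictlyPositive x ∧ logAvg w c x = 0 := by
  obtain ⟨a, b, ha, hb, hab⟩ := exists_smul_one_le_of_forall hc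
  set M := b / a with hMd
  have hM : 0 < M := by positivity
  set K := rpowRemainder M
  have hK : 0 ≤ K := rpowRemainder_nonneg M
  set s : ℕ → ℝ := fun n => 1 / ((n : ℝ) + 1) with hsd
  have hs0 : ∀ n, 0 < s n := fun n => Nat.one_div_pos_of_nat
  have hs1 : ∀ n, s n ≤ 1 := fun n => by
    rw [hsd, div_le_one (by positivity)]; linarith [n.cast_nonneg (α := ℝ)]
  have hanti : ∀ n m, n ≤ m → s m ≤ s n := fun n m h => Nat.one_div_le_one_div h
  have hslim : Tendsto s atTop (𝓝 0) := tendsto_one_div_add_atTop_nhds_zero_nat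
  choose u hu hfix using fun n => exists_gmeanMap_eq hw hc (hs0 n) (hs1 n)
  have hIcc : ∀ n, a • (1 : 𝓐) ≤ u n ∧ u n ≤ b • (1 : 𝓐) := fun n =>
    gmeanMap_eq_mem_Icc hw hc ha hb hab (hs0 n) (hs1 n) (hu n) (hfix n)
  have hspec : ∀ n i, spectrum ℝ (relTo (u n) (c i)) ⊆ Set.Icc M⁻¹ M := fun n i =>
    spectrum_relTo_subset_of_mem_Icc ha hb (hIcc n) (hab i)
  -- The power means decrease with the exponent and satisfy `(1 - K sₙ) uₙ ≤ uₘ ≤ uₙ`, so they are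
  -- Cauchy in norm.
  have hdist : ∀ n m, n ≤ m → dist (u n) (u m) ≤ K * s n * ‖b • (1 : 𝓐)‖ := by
    intro n m hnm
    have hle : u m ≤ u n := (hu m).le_of_gmeanMap hw hc (hs0 n) (hs1 n) (hu n)
      (le_gmeanMap_of_eq_gmeanMap hw hc (hu m) (hs0 m) (hanti n m hnm) (hfix m)) (hfix n).ge
    have h2 := smul_le_of_gmeanMap_eq hw hc (hu n) (hu m) hM (hspec n) (hs0 m) (hs1 m)
      (hs0 n) (hs1 n) (hfix n) (hfix m)
    have hKs : 0 ≤ K * s n := mul_nonneg hK (hs0 n).le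
    have h3 : u n - u m ≤ (K * s n) • u n := by
      rw [sub_smul, one_smul, sub_le_iff_le_add] at h2
      rwa [sub_le_iff_le_add']
    rw [dist_eq_norm]
    refine (CStarAlgebra.norm_le_norm_of_nonneg_of_le (sub_nonneg.mpr hle) h3).trans ?_
    rw [norm_smul, Real.norm_of_nonneg hKs]
    exact mul_le_mul_of_nonneg_left
      (CStarAlgebra.norm_le_norm_of_nonneg_of_le (hu n).nonneg (hIcc n).2) hKs
  have hcau : CauchySeq u := by
    refine cauchySeq_of_le_tendsto_0' (fun n => K * s n * ‖b • (1 : 𝓐)‖) hdist ?_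
    simpa using (hslim.const_mul K).mul_const ‖b • (1 : 𝓐)‖
  obtain ⟨x, hx⟩ := cauchySeq_tendsto_of_complete hcau
  have hxpos : IsStrictlyPositive x :=
    (isStrictlyPositive_one.smul ha : IsStrictlyPositive (a • (1 : 𝓐))).of_le
      (ge_of_tendsto' hx fun n => (hIcc n).1)
  have hlog : Tendsto (fun n => logAvg w c (u n)) atTop (𝓝 (logAvg w c x)) :=
    ((continuousOn_logAvg hc x hxpos).tendsto).comp
      (tendsto_nhdsWithin_iff.mpr ⟨hx, Eventually.of_forall hu⟩)
  have hbd := fun n => logAvg_of_gmeanMap_eq hw hc (hu n) hM (hspec n) (hs0 n) (hs1 n) (hfix n)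
  refine ⟨x, hxpos, le_antisymm (le_of_tendsto' hlog fun n => (hbd n).2) ?_⟩
  have hl0 : Tendsto (fun n => -((K * s n) • (1 : 𝓐))) atTop (𝓝 0) := by
    simpa using ((hslim.const_mul K).smul_const (1 : 𝓐)).neg
  exact le_of_tendsto_of_tendsto' hl0 hlog fun n => (hbd n).1

theorem existsUnique_logAvg_eq_zero (hw : w ∈ posSimplex k)
    (hc : ∀ i, IsStrictlyPositive (c i)) :
    ∃! x : 𝓐, IsStrictlyPositive x ∧ logAvg w c x = 0 := by
  obtain ⟨x, hx, hxl⟩ := exists_logAvg_eq_zero hw hc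
  exact ⟨x, ⟨hx, hxl⟩, fun y ⟨hy, hyl⟩ => le_antisymm
    (le_of_logAvg_nonneg_of_logAvg_nonpos hw hc hy hx hyl.ge hxl.le)
    (le_of_logAvg_nonneg_of_logAvg_nonpos hw hc hx hy hxl.ge hyl.le)⟩

/-- If the logarithmic average at `x` is nonnegative, `x` lies below the arithmetic mean. -/
theorem le_sum_smul_of_logAvg_nonneg (hw : w ∈ posSimplex k)
    (hc : ∀ i, IsStrictlyPositive (c i)) {x : 𝓐} (hx : IsStrictlyPositive x)
    (h : 0 ≤ logAvg w c x) : x ≤ ∑ i, w i • c i := by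
  rw [← gmeanMap_one hc hx]
  exact le_gmeanMap_of_logAvg_nonneg hw hc hx h zero_le_one

/-- At `x⁻¹` the average of exponent `-r` equals 1, and `1 - r logAvg ≤ 1` forces the logarithmic
average to be nonnegative there. -/
theorem inverse_le_sum_smul_of_gmeanMap_inverse_eq (hw : w ∈ posSimplex k)
    (hc : ∀ i, IsStrictlyPositive (c i)) {x : 𝓐} (hx : IsStrictlyPositive x) {r : ℝ}
    (hr : 0 < r) (h : x = gmeanMap r w (fun i => Ring.inverse (c i)) x) :
    Ring.inverse x ≤ ∑ i, w i • c i := by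
  refine le_sum_smul_of_logAvg_nonneg hw hc hx.ringInverse ?_
  have h1 := powAvg_inverse (w := w) hc hx.ringInverse r
  rw [Ring.inverse_inverse hx.isUnit, powAvg_eq_one_of_gmeanMap_eq hx h] at h1
  have h2 := one_add_smul_logAvg_le_powAvg hw hc hx.ringInverse (-r)
  rw [← h1, add_le_iff_nonpos_right, neg_smul, neg_nonpos] at h2
  exact (smul_nonneg_iff_nonneg_of_pos_left hr).1 h2

end KarcherEquation

/-! ### Scalar power means. -/

section RealPowerMean

variable {k : ℕ} {w a : Fin k → ℝ}

theorem realPowerMean_one (w a : Fin k → ℝ) : realPowerMean 1 w a = ∑ i, w i * a i := by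
  simp [realPowerMean]

theorem realPowerMean_mono (hw : w ∈ posSimplex k) (ha : ∀ i, 0 < a i) {p q : ℝ} (hp : 0 < p)
    (hpq : p ≤ q) : realPowerMean p w a ≤ realPowerMean q w a := by
  have hnn : ∀ i, 0 ≤ a i ^ p := fun i => (Real.rpow_pos_of_pos (ha i) p).le
  have h := Real.arith_mean_le_rpow_mean Finset.univ w (fun i => a i ^ p)
    (fun i _ => (hw.1 i).le) hw.2 (fun i _ => hnn i) (p := q / p) ((one_le_div hp).mpr hpq)
  have h0 : 0 ≤ ∑ i, w i * a i ^ p := Finset.sum_nonneg fun i _ => mul_nonneg (hw.1 i).le (hnn i)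
  have h1 : 0 ≤ ∑ i, w i * a i ^ q := Finset.sum_nonneg fun i _ =>
    mul_nonneg (hw.1 i).le (Real.rpow_pos_of_pos (ha i) q).le
  have h2 : ∀ i, (a i ^ p) ^ (q / p) = a i ^ q := fun i => by
    rw [← Real.rpow_mul (ha i).le, mul_div_cancel₀ q hp.ne']
  simp only [h2] at h
  refine (Real.rpow_le_rpow h0 h (by positivity : 0 ≤ 1 / p)).trans_eq ?_
  rw [← Real.rpow_mul h1, realPowerMean]
  congr 1
  field_simp

end RealPowerMean

/-! ### Concavity and monotonicity of `G^μ` in the parameter. -/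

section OrderedMean

variable {H : Type*} [NormedAddCommGroup H] [InnerProductSpace ℂ H] [CompleteSpace H]
  {n k : ℕ} {ω : Fin n → ℝ}

namespace OrderedMean

theorem toFun_add_le (G : OrderedMean H) (hω : ω ∈ posSimplex n) {A B : Fin n → H →L[ℂ] H}
    (hA : ∀ i, IsStrictlyPositive (A i)) (hB : ∀ i, IsStrictlyPositive (B i)) :
    G.toFun n ω A + G.toFun n ω B ≤ G.toFun n ω (fun i => A i + B i) := by
  have h2 : (0 : ℝ) < 2 := two_pos
  -- Doubling the arguments cancels the midpoint weights by homogeneity.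
  have h := G.jointly_concave n ω (fun i => (2 : ℝ) • A i) (fun i => (2 : ℝ) • B i) (1 / 2) hω
    (fun i => (hA i).smul h2) (fun i => (hB i).smul h2) (by norm_num) (by norm_num)
  rw [G.homogeneous n ω A 2 hω hA h2, G.homogeneous n ω B 2 hω hB h2] at h
  norm_num [smul_smul] at h
  exact h

theorem toFun_one (G : OrderedMean H) (hω : ω ∈ posSimplex n) :
    G.toFun n ω (fun _ => (1 : H →L[ℂ] H)) = 1 := by
  have h1 : ∀ _ : Fin n, IsStrictlyPositive (1 : H →L[ℂ] H) := fun _ => isStrictlyPositive_one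
  refine le_antisymm ?_ ?_
  · simpa only [arithMean, sum_smul_const hω] using G.le_arith n ω _ hω h1
  · simpa only [harmMean, Ring.inverse_one, sum_smul_const hω] using G.harm_le n ω _ hω h1

theorem toFun_add_smul_one_le (G : OrderedMean H) (hω : ω ∈ posSimplex n)
    {A : Fin n → H →L[ℂ] H} (hA : ∀ i, IsStrictlyPositive (A i)) {t : ℝ} (ht : 0 ≤ t) :
    G.toFun n ω A + t • (1 : H →L[ℂ] H) ≤
      G.toFun n ω (fun i => A i + t • (1 : H →L[ℂ] H)) := by
  rcases ht.eq_or_lt with rfl | ht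
  · simp
  · have h1 : ∀ _ : Fin n, IsStrictlyPositive (1 : H →L[ℂ] H) := fun _ => isStrictlyPositive_one
    have := G.toFun_add_le hω hA fun i => (h1 i).smul ht
    rwa [G.homogeneous n ω _ t hω h1 ht, G.toFun_one hω] at this

theorem param_of_nonneg {K : Type*} [NormedAddCommGroup K] [InnerProductSpace ℂ K]
    (G : OrderedMean K) {t : ℝ} (ht : 0 ≤ t) (ω : Fin n → ℝ) (A : Fin n → K →L[ℂ] K) :
    G.param t ω A =
      G.toFun n ω (fun i => A i + t • (1 : K →L[ℂ] K)) - t • (1 : K →L[ℂ] K) :=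
  if_pos ht

theorem isStrictlyPositive_param (G : OrderedMean H) (hω : ω ∈ posSimplex n)
    {A : Fin n → H →L[ℂ] H} (hA : ∀ i, IsStrictlyPositive (A i)) {t : ℝ} (ht : 0 ≤ t) :
    IsStrictlyPositive (G.param t ω A) := by
  refine (G.isStrictlyPositive n ω A hω hA).of_le ?_
  rw [G.param_of_nonneg ht, le_sub_iff_add_le]
  exact G.toFun_add_smul_one_le hω hA ht

theorem isStrictlyPositive_add_smul_one {T : H →L[ℂ] H} (hT : IsStrictlyPositive T) {t : ℝ}
    (ht : 0 ≤ t) : IsStrictlyPositive (T + t • (1 : H →L[ℂ] H)) :=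
  hT.add_nonneg (smul_nonneg ht zero_le_one)

theorem param_mono (G : OrderedMean H) (hω : ω ∈ posSimplex n)
    {A : Fin n → H →L[ℂ] H} (hA : ∀ i, IsStrictlyPositive (A i)) {s t : ℝ} (hs : 0 ≤ s)
    (hst : s ≤ t) : G.param s ω A ≤ G.param t ω A := by
  rw [G.param_of_nonneg hs, G.param_of_nonneg (hs.trans hst), sub_le_iff_le_add,
    sub_add_eq_add_sub, le_sub_iff_add_le]
  have := G.toFun_add_smul_one_le hω (fun i => isStrictlyPositive_add_smul_one (hA i) hs)
    (sub_nonneg.mpr hst)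
  simp only [add_assoc, ← add_smul, add_sub_cancel] at this
  calc _ = G.toFun n ω (fun i => A i + s • (1 : H →L[ℂ] H)) + (t - s) • (1 : H →L[ℂ] H) +
        s • (1 : H →L[ℂ] H) := by rw [sub_smul]; abel
    _ ≤ _ := add_le_add_left this _

/-- Induction starts from singletons because the axioms say nothing at 0; positivity of the partial
sums is carried along for `toFun_add_le`. -/
theorem sum_smul_toFun_le (G : OrderedMean H) (hω : ω ∈ posSimplex n) {ι : Type*}
    {s : Finset ι} (hs : s.Nonempty) {lam : ι → ℝ} (hlam : ∀ j, 0 < lam j)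
    {B : ι → Fin n → H →L[ℂ] H} (hB : ∀ j i, IsStrictlyPositive (B j i)) :
    (∀ i, IsStrictlyPositive (∑ j ∈ s, lam j • B j i)) ∧
      ∑ j ∈ s, lam j • G.toFun n ω (B j) ≤ G.toFun n ω (fun i => ∑ j ∈ s, lam j • B j i) := by
  induction hs using Finset.Nonempty.cons_induction with
  | singleton a =>
    simp only [Finset.sum_singleton]
    exact ⟨fun i => (hB a i).smul (hlam a),
      (G.homogeneous n ω (B a) (lam a) hω (hB a) (hlam a)).ge⟩
  | cons a s ha hs ih =>
    simp only [Finset.sum_cons]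
    have h1 := fun i => (hB a i).smul (hlam a)
    refine ⟨fun i => (h1 i).add_nonneg (ih.1 i).nonneg, ?_⟩
    refine le_trans ?_ (G.toFun_add_le hω h1 ih.1)
    rw [G.homogeneous n ω (B a) (lam a) hω (hB a) (hlam a)]
    exact add_le_add_right ih.2 _

theorem sum_smul_param_le (G : OrderedMean H) (hω : ω ∈ posSimplex n)
    {A : Fin n → H →L[ℂ] H} (hA : ∀ i, IsStrictlyPositive (A i)) {lam μ : Fin k → ℝ}
    (hlam : lam ∈ posSimplex k) (hμ : ∀ j, 0 < μ j) :
    ∑ j, lam j • G.param (μ j) ω A ≤ G.param (∑ j, lam j * μ j) ω A := by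
  have hne : (Finset.univ : Finset (Fin k)).Nonempty := by
    by_contra hcon
    have := hlam.2
    simp [Finset.not_nonempty_iff_eq_empty.mp hcon] at this
  have h0 : 0 ≤ ∑ j, lam j * μ j :=
    Finset.sum_nonneg fun j _ => mul_nonneg (hlam.1 j).le (hμ j).le
  have h := (G.sum_smul_toFun_le hω hne hlam.1
    (B := fun j i => A i + μ j • (1 : H →L[ℂ] H))
    fun j i => isStrictlyPositive_add_smul_one (hA i) (hμ j).le).2
  simp only [G.param_of_nonneg (hμ _).le, G.param_of_nonneg h0, smul_sub,
    Finset.sum_sub_distrib, smul_smul, ← Finset.sum_smul]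
  -- As the weights sum to 1, averaging the shifted tuples `A + μⱼ I` shifts `A` by the average of
  -- the `μⱼ`.
  simp only [smul_add, Finset.sum_add_distrib, sum_smul_const hlam, smul_smul,
    ← Finset.sum_smul] at h
  exact sub_le_sub_right h _

end OrderedMean

end OrderedMean

/-! ### Power and Karcher means of operators, and their order. -/

section PowerMean

variable {H : Type*} [NormedAddCommGroup H] [InnerProductSpace ℂ H] [CompleteSpace H]
  {k : ℕ} {w : Fin k → ℝ} {C : Fin k → H →L[ℂ] H}

/-- Each argument of the logarithm is the inverse of `relTo X (C i)`, so the two sums differ only in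
sign. -/
theorem solvesKarcherEq_iff (hC : ∀ i, IsStrictlyPositive (C i)) {X : H →L[ℂ] H} :
    SolvesKarcherEq w C X ↔ IsStrictlyPositive X ∧ logAvg w C X = 0 := by
  refine and_congr_right fun hX => ?_
  simp only [conj_inverse_eq_relTo_rpow hX (hC _), log_rpow (hX.relTo (hC _)), neg_smul, one_smul,
    smul_neg, Finset.sum_neg_distrib, neg_eq_zero]
  rfl

theorem existsUnique_solvesPowerEq (hw : w ∈ posSimplex k) (hC : ∀ i, IsStrictlyPositive (C i))
    {r : ℝ} (hr0 : 0 < r) (hr1 : r ≤ 1) : ∃! X, SolvesPowerEq r w C X :=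
  existsUnique_gmeanMap_eq hw hC hr0 hr1

theorem existsUnique_solvesKarcherEq (hw : w ∈ posSimplex k)
    (hC : ∀ i, IsStrictlyPositive (C i)) : ∃! X, SolvesKarcherEq w C X := by
  simpa only [solvesKarcherEq_iff hC] using existsUnique_logAvg_eq_zero hw hC

theorem solvesKarcherEq_karcherMean (hw : w ∈ posSimplex k)
    (hC : ∀ i, IsStrictlyPositive (C i)) : SolvesKarcherEq w C (karcherMean w C) :=
  Classical.epsilon_spec (existsUnique_solvesKarcherEq hw hC).exists

theorem solvesPowerEq_powerMean (hw : w ∈ posSimplex k) (hC : ∀ i, IsStrictlyPositive (C i))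
    {r : ℝ} (hr0 : 0 < r) (hr1 : r ≤ 1) : SolvesPowerEq r w C (powerMean r w C) := by
  rw [powerMean, if_pos hr0]
  exact Classical.epsilon_spec (existsUnique_solvesPowerEq hw hC hr0 hr1).exists

theorem powerMean_mono (hw : w ∈ posSimplex k) (hC : ∀ i, IsStrictlyPositive (C i))
    {r s : ℝ} (hr0 : 0 < r) (hrs : r ≤ s) (hs1 : s ≤ 1) :
    powerMean r w C ≤ powerMean s w C := by
  obtain ⟨hX, hXr⟩ := solvesPowerEq_powerMean hw hC hr0 (hrs.trans hs1)
  obtain ⟨hY, hYs⟩ := solvesPowerEq_powerMean hw hC (hr0.trans_le hrs) hs1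
  exact hX.le_of_gmeanMap hw hC (hr0.trans_le hrs) hs1 hY
    (le_gmeanMap_of_eq_gmeanMap hw hC hX hr0 hrs hXr) hYs.ge

theorem karcherMean_le_powerMean (hw : w ∈ posSimplex k) (hC : ∀ i, IsStrictlyPositive (C i))
    {r : ℝ} (hr0 : 0 < r) (hr1 : r ≤ 1) : karcherMean w C ≤ powerMean r w C := by
  obtain ⟨hX, hXl⟩ := (solvesKarcherEq_iff hC).1 (solvesKarcherEq_karcherMean hw hC)
  obtain ⟨hY, hYr⟩ := solvesPowerEq_powerMean hw hC hr0 hr1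
  exact hX.le_of_gmeanMap hw hC hr0 hr1 hY
    (le_gmeanMap_of_logAvg_nonneg hw hC hX hXl.ge hr0.le) hYr.ge

theorem powerMean_le_sum_smul (hw : w ∈ posSimplex k) (hC : ∀ i, IsStrictlyPositive (C i))
    {p : ℝ} (hp0 : -1 ≤ p) (hp1 : p ≤ 1) : powerMean p w C ≤ ∑ i, w i • C i := by
  rcases lt_trichotomy p 0 with hp | rfl | hp
  · have hC' := fun i => (hC i).ringInverse
    obtain ⟨hX, hXr⟩ := solvesPowerEq_powerMean hw hC' (r := -p) (by linarith) (by linarith)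
    have h := inverse_le_sum_smul_of_gmeanMap_inverse_eq hw hC hX (by linarith) hXr
    rw [powerMean, if_pos (by linarith)] at h
    rwa [powerMean, if_neg hp.not_gt, if_pos hp]
  · obtain ⟨hX, hXl⟩ := (solvesKarcherEq_iff hC).1 (solvesKarcherEq_karcherMean hw hC)
    rw [powerMean, if_neg (lt_irrefl _), if_neg (lt_irrefl _)]
    exact le_sum_smul_of_logAvg_nonneg hw hC hX hXl.ge
  · obtain ⟨hX, hXr⟩ := solvesPowerEq_powerMean hw hC hp hp1
    -- The arithmetic mean is the exponent 1 map evaluated at any point, here at the power mean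
    -- itself.
    rw [← gmeanMap_one hC hX]
    exact le_gmeanMap_of_eq_gmeanMap hw hC hX hp hp1 hXr

end PowerMean

theorem theoremT {H : Type*} [NormedAddCommGroup H] [InnerProductSpace ℂ H] [CompleteSpace H]
    (G : OrderedMean H) (n k : ℕ) (A : Fin n → H →L[ℂ] H) (hA : ∀ i, IsStrictlyPositive (A i))
    (ω : Fin n → ℝ) (hω : ω ∈ posSimplex n) (lam : Fin k → ℝ) (hlam : lam ∈ posSimplex k)
    (μ : Fin k → ℝ) (hμ : ∀ j, 0 < μ j) :
    -- the power means and the Karcher mean are well defined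
    (∀ C : Fin k → H →L[ℂ] H, (∀ j, IsStrictlyPositive (C j)) →
      (∀ r : ℝ, 0 < r → r ≤ 1 → ∃! X, SolvesPowerEq r lam C X) ∧
      ∃! X, SolvesKarcherEq lam C X) ∧
    (∀ j, IsStrictlyPositive (G.param (μ j) ω A)) ∧
    -- the main inequality
    (∀ p q : ℝ, -1 ≤ p → p ≤ 1 → 1 ≤ q →
      powerMean p lam (fun j => G.param (μ j) ω A) ≤ G.param (realPowerMean q lam μ) ω A) ∧
    -- the chain of inequalities
    (∀ p q : ℝ, 1 ≤ p → p ≤ q →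
      karcherMean lam (fun j => G.param (μ j) ω A)
          ≤ powerMean (1 / q) lam (fun j => G.param (μ j) ω A) ∧
      powerMean (1 / q) lam (fun j => G.param (μ j) ω A)
          ≤ powerMean (1 / p) lam (fun j => G.param (μ j) ω A) ∧
      powerMean (1 / p) lam (fun j => G.param (μ j) ω A)
          ≤ G.param (realPowerMean p lam μ) ω A ∧
      G.param (realPowerMean p lam μ) ω A ≤ G.param (realPowerMean q lam μ) ω A) := by
  have hD : ∀ j, IsStrictlyPositive (G.param (μ j) ω A) := fun j =>
    G.isStrictlyPositive_param hω hA (hμ j).le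
  have hm0 : 0 ≤ ∑ j, lam j * μ j :=
    Finset.sum_nonneg fun j _ => mul_nonneg (hlam.1 j).le (hμ j).le
  have hm : ∀ q : ℝ, 1 ≤ q → ∑ j, lam j * μ j ≤ realPowerMean q lam μ := fun q hq => by
    rw [← realPowerMean_one]
    exact realPowerMean_mono hlam hμ one_pos hq
  have main : ∀ p q : ℝ, -1 ≤ p → p ≤ 1 → 1 ≤ q →
      powerMean p lam (fun j => G.param (μ j) ω A) ≤ G.param (realPowerMean q lam μ) ω A :=
    fun p q hp0 hp1 hq => (powerMean_le_sum_smul hlam hD hp0 hp1).trans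
      ((G.sum_smul_param_le hω hA hlam hμ).trans (G.param_mono hω hA hm0 (hm q hq)))
  refine ⟨fun C hC => ⟨fun r hr0 hr1 => existsUnique_solvesPowerEq hlam hC hr0 hr1,
    existsUnique_solvesKarcherEq hlam hC⟩, hD, main, fun p q hp hpq => ?_⟩
  have hp0 : 0 < p := by linarith
  have hq0 : 0 < q := by linarith
  have hp1 : 1 / p ≤ 1 := (div_le_one hp0).mpr hp
  have hqp : 1 / q ≤ 1 / p := one_div_le_one_div_of_le hp0 hpq
  have hpp : 0 < 1 / p := by positivity
  have hqq : 0 < 1 / q := by positivity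
  exact ⟨karcherMean_le_powerMean hlam hD hqq (hqp.trans hp1), powerMean_mono hlam hD hqq hqp hp1,
    main _ _ (by linarith) hp1 hp,
    G.param_mono hω hA (hm0.trans (hm p hp)) (realPowerMean_mono hlam hμ hp0 hpq)⟩
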